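/- Let $m\ge 3$ and $n\ge m$ be integers. For a real $n\times m$ matrix $A$ with rows $a_1,\dots,a_n$ let $\theta_i(A,x)\in[0,\pi]$ denote the angle between $a_i$ and $x\in\mathbb{R}^m\setminus\{0\}$, let $$\theta(A)=\sup_{x\in\mathbb{R}^m\setminus\{0\}}\ \min_{1\le i\le n}\theta_i(A,x),$$ and let $\mathscr{C}(A)=|\cos\theta(A)|^{-1}\in[1,\infty]$ (with $\mathscr{C}(A)=\infty$ if $\cos\theta(A)=0$). Let $A$ be a random $n\times m$ matrix whose rows are either i.i.d. and uniformly distributed on the unit sphere $S^{m-1}\subset\mathbb{R}^m$, or i.i.d. standard Gaussian vectors in $\mathbb{R}^m$ (that is, the entries of $A$ are i.i.d. standard normal). Then for every real $t\ge 1$, $$\mathbf{P}\left[\mathscr{C}(A)\ge t\right]\le\binom{n}{m}\cdot 2m^{5/2}\cdot\left(1-\frac{I_{m-2}\left(\arccos(1/t)\right)}{I_{m-2}(\pi)}\right)^{n-m}\cdot\frac1t,$$ where $I_k(\rho)=\int_0^\rho\sin^k x\,dx$. -/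

import Mathlib

open MeasureTheory ProbabilityTheory

/-- The `i`-th row of `A`, as a vector of the Euclidean space `ℝ^m`. -/
def matRow {n m : ℕ} (A : Matrix (Fin n) (Fin m) ℝ) (i : Fin n) : EuclideanSpace ℝ (Fin m) :=
  WithLp.toLp 2 (A i)

/-- `θ(A, x) = min_i θ_i(A, x)`, where `θ_i(A, x) ∈ [0, π]` is the angle between the `i`-th row
of `A` and `x`. -/
noncomputable def minAngle {n m : ℕ} (A : Matrix (Fin n) (Fin m) ℝ)
    (x : EuclideanSpace ℝ (Fin m)) : ℝ :=
  ⨅ i : Fin n, InnerProductGeometry.angle (matRow A i) x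

/-- `θ(A) = sup_{x ≠ 0} θ(A, x)`. -/
noncomputable def maxMinAngle {n m : ℕ} (A : Matrix (Fin n) (Fin m) ℝ) : ℝ :=
  ⨆ x : {x : EuclideanSpace ℝ (Fin m) // x ≠ 0}, minAngle A x

/-- The condition number `𝒞(A) = |cos θ(A)|⁻¹ ∈ [1, ∞]`, which is `∞` when `cos θ(A) = 0`. -/
noncomputable def condNumber {n m : ℕ} (A : Matrix (Fin n) (Fin m) ℝ) : ENNReal :=
  (ENNReal.ofReal |Real.cos (maxMinAngle A)|)⁻¹

/-- The uniform probability measure on the unit sphere of `ℝ^m` (normalised surface measure),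
seen as a measure on `ℝ^m`. -/
noncomputable def sphereUniform (m : ℕ) : Measure (EuclideanSpace ℝ (Fin m)) :=
  let σ : Measure (Metric.sphere (0 : EuclideanSpace ℝ (Fin m)) 1) :=
    (volume : Measure (EuclideanSpace ℝ (Fin m))).toSphere
  ((σ Set.univ)⁻¹ • σ).map Subtype.val

/-- The rows of `A` are i.i.d. and uniformly distributed on the unit sphere. -/
def IsUniformRandomMatrix {Ω : Type*} [MeasurableSpace Ω] {n m : ℕ}
    (A : Ω → Matrix (Fin n) (Fin m) ℝ) (P : Measure Ω) : Prop :=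
  iIndepFun (fun (i : Fin n) (ω : Ω) => matRow (A ω) i) P ∧
    ∀ i : Fin n, HasLaw (fun ω => matRow (A ω) i) (sphereUniform m) P

/-- The entries of `A` are i.i.d. standard normal random variables. -/
def IsGaussianRandomMatrix {Ω : Type*} [MeasurableSpace Ω] {n m : ℕ}
    (A : Ω → Matrix (Fin n) (Fin m) ℝ) (P : Measure Ω) : Prop :=
  iIndepFun (fun (p : Fin n × Fin m) (ω : Ω) => A ω p.1 p.2) P ∧
    ∀ (i : Fin n) (j : Fin m), HasLaw (fun ω => A ω i j) (gaussianReal 0 1) P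

/-- `I_k(ρ) = ∫_0^ρ sin^k x dx`. -/
noncomputable def sinPowIntegral (k : ℕ) (ρ : ℝ) : ℝ :=
  ∫ x in (0 : ℝ)..ρ, Real.sin x ^ k

/-! Put s = 1/t and replace every row by its direction, which changes no angle with a nonzero x.
Then cos θ(A) is the minimum over unit x of max_i ⟨a_i, x⟩, and 𝒞(A) ≥ t means |cos θ(A)| ≤ s. So
some unit x has all ⟨a_i, x⟩ ≤ s, while every unit x has some ⟨a_i, x⟩ ≥ -s.

Geometry (`exists_badBlocks`). Let the rows be in general position. If 0 lies in their convex hull,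
the min-max value c is in (0, s] and is attained at a point x where at least m rows satisfy ⟨a_i, x⟩
= c. Otherwise the point p of least norm in the hull has ‖p‖ ≤ s and is a combination of at most m
rows. Either way m rows b carry two separate defects. They fix a centre, x or p, that confines each
of the other n - m rows to a half-space. Also, a short combination of b has a large coefficient sum,
so one b_k lies within m·s of a hyperplane containing the others.

Probability (`measure_pi_le`). General position holds almost surely, and a union bound over blocks
costs the binomial coefficient. The near-hyperplane event depends on b alone and has probability at
most m·κ, with κ bounding the mass of a slab of half-width m·s. For fixed independent b there is at
most one x and one p, so by independence the other rows obey the centre condition with probability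
at most 2q^(n-m), with q bounding the mass of {⟨a, x⟩ ≤ s}.

Both models give ⟨a, u⟩ the law of cos φ with φ of density proportional to sin^(m-2)
(`HasCosineLaw`). Hence q is the bracket in the statement, and κ = √m·m·s works because I_{m-2}(π) ≥
2/√m. The product m·κ·2q^(n-m) is the claimed bound. -/

/-! ### Convex geometry of badly conditioned families. -/

section Deterministic

variable {E : Type*} [NormedAddCommGroup E] [InnerProductSpace ℝ E] [FiniteDimensional ℝ E]

omit [FiniteDimensional ℝ E] in
theorem inner_eq_zero_of_mem_span_range {ι : Type*} {b : ι → E} {y : E}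
    (hy : ∀ i, inner ℝ (b i) y = 0) {v : E} (hv : v ∈ Submodule.span ℝ (Set.range b)) :
    inner ℝ v y = 0 := by
  induction hv using Submodule.span_induction with
  | mem v hv => obtain ⟨i, rfl⟩ := hv; exact hy i
  | zero => simp
  | add u v _ _ hu hv => rw [inner_add_left, hu, hv, add_zero]
  | smul c v _ hv => rw [inner_smul_left, hv, mul_zero]

/-- Fewer vectors than the dimension have a common unit normal. -/
theorem exists_unit_orthogonal_of_card_lt {ι : Type*} (s : Finset ι) (a : ι → E)
    (h : s.card < Module.finrank ℝ E) :
    ∃ u : E, ‖u‖ = 1 ∧ ∀ i ∈ s, inner ℝ (a i) u = 0 := by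
  classical
  set K := Submodule.span ℝ (a '' (s : Set ι)) with hK
  have hlt : Module.finrank ℝ K < Module.finrank ℝ E := by
    refine lt_of_le_of_lt ?_ h
    have h1 := finrank_span_finset_le_card (R := ℝ) (s.image a)
    rw [Finset.coe_image] at h1
    exact h1.trans Finset.card_image_le
  have hpos : 0 < Module.finrank ℝ Kᗮ := by
    have := Submodule.finrank_add_finrank_orthogonal K
    omega
  have : Nontrivial Kᗮ := Module.finrank_pos_iff.mp hpos
  obtain ⟨v, hv⟩ := exists_ne (0 : Kᗮ)
  have hv' : (v : E) ≠ 0 := fun h0 => hv (Subtype.ext h0)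
  refine ⟨‖(v : E)‖⁻¹ • (v : E), norm_smul_inv_norm hv', fun i hi => ?_⟩
  rw [inner_smul_right, Submodule.inner_right_of_mem_orthogonal
    (Submodule.subset_span (Set.mem_image_of_mem a hi)) v.2, mul_zero]

/-- If a short combination of the `b i` has a large coefficient sum, then one of the `b i` is
close to a hyperplane containing all the others. -/
theorem exists_near_hyperplane {m : ℕ} (hm : Module.finrank ℝ E = m) (b : Fin m → E)
    (l : Fin m → ℝ) {s : ℝ} (hs : 0 ≤ s) (h0 : ∑ i, l i ≠ 0)
    (h : ‖∑ i, l i • b i‖ ≤ s * |∑ i, l i|) :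
    ∃ k, ∃ u : E, ‖u‖ = 1 ∧ (∀ i, i ≠ k → inner ℝ (b i) u = 0) ∧
      |inner ℝ (b k) u| ≤ m * s := by
  have hne : (Finset.univ : Finset (Fin m)).Nonempty := by
    rw [Finset.nonempty_iff_ne_empty]
    intro he
    simp [he] at h0
  -- Take the largest coefficient, so that |∑ l i| ≤ m |l k|. Pairing the combination with a unit
  -- normal to the other vectors isolates l k ⟨b k, u⟩.
  obtain ⟨k, -, hk⟩ := Finset.exists_max_image Finset.univ (fun i => |l i|) hne
  have hsum : |∑ i, l i| ≤ m * |l k| := by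
    calc |∑ i, l i| ≤ ∑ i, |l i| := Finset.abs_sum_le_sum_abs _ _
      _ ≤ ∑ _i : Fin m, |l k| := Finset.sum_le_sum fun i hi => hk i hi
      _ = m * |l k| := by simp
  have hlk : 0 < |l k| := by
    by_contra hcon
    have : |l k| = 0 := le_antisymm (not_lt.mp hcon) (abs_nonneg _)
    rw [this, mul_zero] at hsum
    exact h0 (abs_eq_zero.mp (le_antisymm hsum (abs_nonneg _)))
  obtain ⟨u, hu1, hu⟩ := exists_unit_orthogonal_of_card_lt (Finset.univ.erase k) b (by
    rw [Finset.card_erase_of_mem (Finset.mem_univ k), Finset.card_univ, Fintype.card_fin, hm]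
    have := k.2
    omega)
  have hu' : ∀ i, i ≠ k → inner ℝ (b i) u = 0 := fun i hi =>
    hu i (Finset.mem_erase.mpr ⟨hi, Finset.mem_univ i⟩)
  refine ⟨k, u, hu1, hu', ?_⟩
  have hin : inner ℝ (∑ i, l i • b i) u = l k * inner ℝ (b k) u := by
    rw [sum_inner, Finset.sum_eq_single k]
    · rw [real_inner_smul_left]
    · intro i _ hi
      rw [real_inner_smul_left, hu' i hi, mul_zero]
    · simp
  have h1 : |l k| * |inner ℝ (b k) u| ≤ |l k| * (m * s) := by
    rw [← abs_mul, ← hin]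
    calc |inner ℝ (∑ i, l i • b i) u| ≤ ‖∑ i, l i • b i‖ * ‖u‖ := abs_real_inner_le_norm _ _
      _ ≤ s * |∑ i, l i| := by rw [hu1, mul_one]; exact h
      _ ≤ s * (m * |l k|) := by gcongr
      _ = |l k| * (m * s) := by ring
  exact le_of_mul_le_mul_left h1 hlk

omit [FiniteDimensional ℝ E] in
/-- The point of minimal norm in the convex hull of finitely many points. -/
theorem exists_min_norm_point {ι : Type*} [Finite ι] [Nonempty ι] (a : ι → E) :
    ∃ p ∈ convexHull ℝ (Set.range a), ∀ i, ‖p‖ ^ 2 ≤ inner ℝ (a i) p := by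
  have hcpt : IsCompact (convexHull ℝ (Set.range a)) :=
    (Set.finite_range a).isCompact_convexHull ℝ
  have hne : (convexHull ℝ (Set.range a)).Nonempty :=
    (Set.range_nonempty a).convexHull
  obtain ⟨p, hp, hmin⟩ := exists_norm_eq_iInf_of_complete_convex hne hcpt.isComplete
    (convex_convexHull ℝ _) (0 : E)
  rw [norm_eq_iInf_iff_real_inner_le_zero (convex_convexHull ℝ _) hp] at hmin
  refine ⟨p, hp, fun i => ?_⟩
  have := hmin (a i) (subset_convexHull ℝ _ (Set.mem_range_self i))
  rw [zero_sub, inner_neg_left, inner_sub_right, real_inner_self_eq_norm_sq,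
    real_inner_comm] at this
  linarith

/-- A convex combination lying on a common supporting hyperplane of its points, away from the
origin, can be written with at most `finrank` points. -/
theorem exists_small_support {ι : Type*} (a : ι → E) {p : E}
    (hp : p ∈ convexHull ℝ (Set.range a)) (hp0 : p ≠ 0)
    (hmin : ∀ i, ‖p‖ ^ 2 ≤ inner ℝ (a i) p) :
    ∃ s : Finset ι, s.card ≤ Module.finrank ℝ E ∧ ∃ w : ι → ℝ, (∀ i, 0 ≤ w i) ∧
      (∀ i, i ∉ s → w i = 0) ∧ ∑ i ∈ s, w i = 1 ∧ ∑ i ∈ s, w i • a i = p := by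
  classical
  obtain ⟨κ, _, z, w, hz, haff, hw0, hw1, hwp⟩ := eq_pos_convex_span_of_mem_convexHull hp
  choose g hg using fun k => hz (Set.mem_range_self k)
  have hginj : Function.Injective g := fun k l hkl => by
    apply haff.injective
    rw [← hg, ← hg, hkl]
  have hge : ∀ k, ‖p‖ ^ 2 ≤ inner ℝ (z k) p := fun k => by rw [← hg k]; exact hmin _
  -- The gaps ⟨z k, p⟩ - ‖p‖² are nonnegative and have weighted mean zero with positive weights, so
  -- all vanish. The points used lie in a hyperplane, which saves one point over Carathéodory's
  -- bound.
  have hzero : ∑ k, w k * (inner ℝ (z k) p - ‖p‖ ^ 2) = 0 := by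
    have h1 : ∑ k, w k * inner ℝ (z k) p = ‖p‖ ^ 2 := by
      rw [← real_inner_self_eq_norm_sq]
      nth_rw 2 [← hwp]
      rw [sum_inner]
      simp [real_inner_smul_left]
    simp only [mul_sub, Finset.sum_sub_distrib, h1, ← Finset.sum_mul, hw1]
    ring
  have heq : ∀ k, inner ℝ (z k) p = ‖p‖ ^ 2 := by
    intro k
    have := (Finset.sum_eq_zero_iff_of_nonneg (fun i _ =>
      mul_nonneg (hw0 i).le (sub_nonneg.mpr (hge i)))).mp hzero k (Finset.mem_univ k)
    rcases mul_eq_zero.mp this with h | h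
    · exact absurd h (hw0 k).ne'
    · linarith
  have hspan : vectorSpan ℝ (Set.range z) ≤ (ℝ ∙ p)ᗮ := by
    rw [vectorSpan, Submodule.span_le]
    rintro _ ⟨_, ⟨k, rfl⟩, _, ⟨l, rfl⟩, rfl⟩
    rw [SetLike.mem_coe, Submodule.mem_orthogonal_singleton_iff_inner_left]
    simp [inner_sub_left, heq]
  have hcard : Fintype.card κ ≤ Module.finrank ℝ E := by
    have h1 := haff.card_le_finrank_succ
    have h2 := Submodule.finrank_mono hspan
    have h3 := Submodule.finrank_add_finrank_orthogonal (ℝ ∙ p)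
    rw [finrank_span_singleton hp0] at h3
    omega
  refine ⟨Finset.univ.image g, Finset.card_image_le.trans (by simpa using hcard),
    fun i => ∑ k ∈ Finset.univ.filter (fun k => g k = i), w k,
    fun i => Finset.sum_nonneg fun k _ => (hw0 k).le, ?_, ?_, ?_⟩
  · intro i hi
    apply Finset.sum_eq_zero
    intro k hk
    exact absurd (Finset.mem_image.mpr ⟨k, Finset.mem_univ k, (Finset.mem_filter.mp hk).2⟩) hi
  · rw [Finset.sum_image fun k _ l _ h => hginj h, ← hw1]
    refine Finset.sum_congr rfl fun k _ => ?_
    rw [Finset.sum_eq_single k] <;> simp +contextual [hginj.eq_iff]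
  · rw [Finset.sum_image fun k _ l _ h => hginj h, ← hwp]
    refine Finset.sum_congr rfl fun k _ => ?_
    beta_reduce
    rw [hg, Finset.sum_eq_single k] <;> simp +contextual [hginj.eq_iff]

/-- At a positive minimum on the unit sphere of the maximum of finitely many linear forms, at
least `finrank` of the forms attain the maximum. -/
theorem exists_min_max_point {ι : Type*} [Fintype ι] [Nonempty ι] [Nontrivial E] (a : ι → E)
    (hpos : ∀ x : E, ‖x‖ = 1 → ∃ i, 0 < inner ℝ (a i) x) {s : ℝ}
    (hs : ∃ x : E, ‖x‖ = 1 ∧ ∀ i, inner ℝ (a i) x ≤ s) :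
    ∃ (c : ℝ) (x : E), 0 < c ∧ c ≤ s ∧ ‖x‖ = 1 ∧ (∀ i, inner ℝ (a i) x ≤ c) ∧
      ∃ S : Finset ι, Module.finrank ℝ E ≤ S.card ∧ ∀ i ∈ S, inner ℝ (a i) x = c := by
  classical
  set g : E → ℝ := fun x => Finset.univ.sup' Finset.univ_nonempty fun i => inner ℝ (a i) x with hg
  have hgc : Continuous g := by
    apply Continuous.finset_sup'_apply
    intro i _
    fun_prop
  have hle : ∀ x i, inner ℝ (a i) x ≤ g x := fun x i =>
    Finset.le_sup' (fun i => inner ℝ (a i) x) (Finset.mem_univ i)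
  obtain ⟨x, hx, hmin⟩ := (isCompact_sphere (0 : E) 1).exists_isMinOn
    (NormedSpace.sphere_nonempty.mpr zero_le_one) hgc.continuousOn
  have hx1 : ‖x‖ = 1 := by simpa using hx
  have hmin' : ∀ y : E, ‖y‖ = 1 → g x ≤ g y := fun y hy => hmin (by simpa using hy)
  obtain ⟨i0, hi0⟩ := hpos x hx1
  have hc : 0 < g x := hi0.trans_le (hle x i0)
  refine ⟨g x, x, hc, ?_, hx1, hle x, Finset.univ.filter (fun i => inner ℝ (a i) x = g x), ?_,
    fun i hi => (Finset.mem_filter.mp hi).2⟩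
  · obtain ⟨x0, hx0, h0⟩ := hs
    exact (hmin' x0 hx0).trans (Finset.sup'_le _ _ fun i _ => h0 i)
  by_contra hcard
  obtain ⟨u, hu1, hu⟩ := exists_unit_orthogonal_of_card_lt _ a (not_le.mp hcard)
  -- Moving along v leaves the active forms unchanged and, for small ε, keeps the others below the
  -- maximum. The sign of v makes the norm exceed 1, so normalising would lower the positive
  -- minimum.
  obtain ⟨v, hv1, hv, hvx⟩ : ∃ v : E, ‖v‖ = 1 ∧
      (∀ i, inner ℝ (a i) x = g x → inner ℝ (a i) v = 0) ∧ 0 ≤ inner ℝ x v := by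
    rcases le_total 0 (inner ℝ x u) with h | h
    · exact ⟨u, hu1, fun i hi => hu i (by simp [hi]), h⟩
    · exact ⟨-u, by simpa, fun i hi => by simp [hu i (by simp [hi])], by simpa using h⟩
  have hev : ∀ᶠ ε : ℝ in nhdsWithin 0 (Set.Ioi 0), ∀ i, inner ℝ (a i) (x + ε • v) ≤ g x := by
    rw [Filter.eventually_all]
    intro i
    by_cases hi : inner ℝ (a i) x = g x
    · refine Filter.Eventually.of_forall fun ε => ?_
      rw [inner_add_right, inner_smul_right, hv i hi, hi]
      simp
    · have hlt : inner ℝ (a i) x < g x := lt_of_le_of_ne (hle x i) hi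
      have hcont : Continuous fun ε : ℝ => inner ℝ (a i) (x + ε • v) := by fun_prop
      have : ∀ᶠ ε : ℝ in nhds 0, inner ℝ (a i) (x + ε • v) < g x :=
        hcont.continuousAt.eventually_lt continuousAt_const (by simpa using hlt)
      exact (this.filter_mono nhdsWithin_le_nhds).mono fun ε h => h.le
  obtain ⟨ε, hε, hεpos⟩ := (hev.and self_mem_nhdsWithin).exists
  have hεpos : 0 < ε := hεpos
  set y := x + ε • v with hy
  have hynorm : 1 < ‖y‖ ^ 2 := by
    rw [hy, norm_add_sq_real, hx1, inner_smul_right, norm_smul, hv1, Real.norm_eq_abs,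
      abs_of_pos hεpos]
    have : 0 ≤ ε * inner ℝ x v := by positivity
    have : 0 < ε ^ 2 := by positivity
    nlinarith
  have hy1 : 1 < ‖y‖ := by
    by_contra hcon
    have := norm_nonneg y
    nlinarith [not_lt.mp hcon]
  have hy0 : y ≠ 0 := by
    rintro h
    rw [h, norm_zero] at hy1
    linarith
  have h1 : g x ≤ g (‖y‖⁻¹ • y) := hmin' _ (norm_smul_inv_norm hy0)
  have h2 : g (‖y‖⁻¹ • y) ≤ ‖y‖⁻¹ * g x := by
    apply Finset.sup'_le
    intro i _
    rw [inner_smul_right]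
    gcongr
    exact hε i
  have h3 : ‖y‖⁻¹ * g x < g x := by
    have : ‖y‖⁻¹ < 1 := inv_lt_one_of_one_lt₀ hy1
    nlinarith
  linarith

/-- The blocks `b` (of size `finrank`) and `c` of a family of vectors such that `b` is
nearly degenerate and determines a point with small inner products with all vectors of `c`. -/
structure BadBlocks {m r : ℕ} (s : ℝ) (b : Fin m → E) (c : Fin r → E) : Prop where
  near : ∃ k, ∃ u : E, ‖u‖ = 1 ∧ (∀ i, i ≠ k → inner ℝ (b i) u = 0) ∧ |inner ℝ (b k) u| ≤ m * s
  centre : (∃ d ∈ Set.Icc 0 s, ∃ x : E, ‖x‖ = 1 ∧ (∀ i, inner ℝ (b i) x = d) ∧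
      ∀ j, inner ℝ (c j) x ≤ s) ∨
    ∃ w ∈ stdSimplex ℝ (Fin m), (∀ i, ‖∑ k, w k • b k‖ ^ 2 ≤ inner ℝ (b i) (∑ k, w k • b k)) ∧
      ∀ j, 0 ≤ inner ℝ (c j) (∑ k, w k • b k)

/-- The cases are whether the origin lies in the convex hull: if so, `h1` bounds the min-max value;
if not, `h2` bounds the distance from the origin to the hull. -/
theorem exists_badBlocks {n m r : ℕ} (hE : Module.finrank ℝ E = m) (hm : 0 < m)
    (hnr : n = m + r) (a : Fin n → E)
    (hgp : ∀ f : Fin m → Fin n, Function.Injective f → LinearIndependent ℝ (a ∘ f))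
    {s : ℝ} (hs : 0 ≤ s) (h1 : ∃ x : E, ‖x‖ = 1 ∧ ∀ i, inner ℝ (a i) x ≤ s)
    (h2 : ∀ x : E, ‖x‖ = 1 → ∃ i, -s ≤ inner ℝ (a i) x) :
    ∃ (I : Finset (Fin n)) (hI : I.card = m) (hI' : Iᶜ.card = r),
      BadBlocks s (fun i => a (finSumEquivOfFinset hI hI' (Sum.inl i)))
        (fun j => a (finSumEquivOfFinset hI hI' (Sum.inr j))) := by
  classical
  have : Nonempty (Fin n) := ⟨⟨0, by omega⟩⟩
  have : Nontrivial E := Module.finrank_pos_iff.mp (hE ▸ hm)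
  have hcompl : ∀ I : Finset (Fin n), I.card = m → Iᶜ.card = r := fun I hI => by
    rw [Finset.card_compl, Fintype.card_fin, hI]; omega
  have hinj : ∀ (I : Finset (Fin n)) (hI : I.card = m) (hI' : Iᶜ.card = r),
      Function.Injective fun i : Fin m => finSumEquivOfFinset hI hI' (Sum.inl i) :=
    fun I hI hI' => (Equiv.injective _).comp Sum.inl_injective
  have hrange : ∀ (I : Finset (Fin n)) (hI : I.card = m) (hI' : Iᶜ.card = r) (i : Fin m),
      finSumEquivOfFinset hI hI' (Sum.inl i) ∈ I := fun I hI hI' i => by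
    rw [finSumEquivOfFinset_inl]; exact Finset.orderEmbOfFin_mem _ _ _
  have himage : ∀ (I : Finset (Fin n)) (hI : I.card = m) (hI' : Iᶜ.card = r),
      Finset.univ.image (fun i : Fin m => finSumEquivOfFinset hI hI' (Sum.inl i)) = I :=
    fun I hI hI' => by
      apply Finset.eq_of_subset_of_card_le
      · intro i hi
        obtain ⟨k, -, rfl⟩ := Finset.mem_image.mp hi
        exact hrange I hI hI' k
      · rw [Finset.card_image_of_injective _ (hinj I hI hI'), hI]; simp
  by_cases h0 : (0 : E) ∈ convexHull ℝ (Set.range a)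
  -- If all ⟨a i, x⟩ ≤ 0, the rows with nonzero weight in a convex representation of 0 are
  -- orthogonal to x. At least m of them would span the space; at most m would be dependent. General
  -- position excludes both.
  · have hpos : ∀ x : E, ‖x‖ = 1 → ∃ i, 0 < inner ℝ (a i) x := by
      intro x hx
      by_contra! hcon
      obtain ⟨w, hw, hw0⟩ : ∃ w : Fin n → ℝ, w ∈ stdSimplex ℝ (Fin n) ∧ ∑ i, w i • a i = 0 := by
        obtain ⟨T, w, hw0, hw1, hw⟩ := (convexHull_range_eq_exists_affineCombination a).subset h0
        rw [Finset.affineCombination_eq_linear_combination _ _ _ hw1] at hw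
        refine ⟨fun i => if i ∈ T then w i else 0, ⟨fun i => ?_, by simpa using hw1⟩,
          by simpa using hw⟩
        beta_reduce
        split_ifs with hi
        exacts [hw0 i hi, le_rfl]
      have hw1 := hw.2
      set T := Finset.univ.filter fun i => w i ≠ 0 with hT
      have hx0 : ∀ i ∈ T, inner ℝ (a i) x = 0 := by
        intro i hi
        have hsum : ∑ i, w i * -inner ℝ (a i) x = 0 := by
          have : inner ℝ (∑ i, w i • a i) x = 0 := by rw [hw0, inner_zero_left]
          rw [sum_inner] at this
          simpa [real_inner_smul_left] using this
        have := (Finset.sum_eq_zero_iff_of_nonneg (fun i _ =>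
          mul_nonneg (hw.1 i) (neg_nonneg.mpr (hcon i)))).mp hsum i (Finset.mem_univ i)
        rcases mul_eq_zero.mp this with h | h
        · exact absurd h (Finset.mem_filter.mp hi).2
        · linarith
      rcases le_total m T.card with hc | hc
      · obtain ⟨I, hIT, hI⟩ := Finset.exists_subset_card_eq hc
        have hli := hgp _ (hinj I hI (hcompl I hI))
        have hspan := hli.span_eq_top_of_card_eq_finrank' (by simp [hE])
        have hxx := inner_eq_zero_of_mem_span_range
          (fun i => hx0 _ (hIT (hrange I hI (hcompl I hI) i)))
          (hspan ▸ Submodule.mem_top : x ∈ _)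
        rw [real_inner_self_eq_norm_sq, hx] at hxx
        norm_num at hxx
      · obtain ⟨I, hTI, -, hI⟩ := Finset.exists_subsuperset_card_eq (Finset.subset_univ T) hc
          (by simp; omega)
        have hli := hgp _ (hinj I hI (hcompl I hI))
        rw [Fintype.linearIndependent_iff] at hli
        have hsum : ∑ i ∈ I, w i • a i = 0 := by
          rw [← hw0]
          apply Finset.sum_subset (Finset.subset_univ I)
          intro i _ hi
          have : w i = 0 := by
            by_contra hne
            exact hi (hTI (by simp [hT, hne]))
          rw [this, zero_smul]
        rw [← himage I hI (hcompl I hI), Finset.sum_image fun i _ j _ h => hinj I hI _ h] at hsum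
        have hz := hli (fun i => w (finSumEquivOfFinset hI (hcompl I hI) (Sum.inl i))) hsum
        have hall : ∀ i, w i = 0 := by
          intro i
          by_contra hne
          have hiI : i ∈ I := hTI (by simp [hT, hne])
          rw [← himage I hI (hcompl I hI)] at hiI
          obtain ⟨k, -, rfl⟩ := Finset.mem_image.mp hiI
          exact hne (hz k)
        simp [hall] at hw1
    obtain ⟨c, x, hc, hcs, hx, hle, S, hS, hSc⟩ := exists_min_max_point a hpos h1
    rw [hE] at hS
    obtain ⟨I, hIS, hI⟩ := Finset.exists_subset_card_eq hS
    refine ⟨I, hI, hcompl I hI, ?_, Or.inl ⟨c, ⟨hc.le, hcs⟩, x, hx,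
      fun i => hSc _ (hIS (hrange I hI _ i)), fun j => (hle _).trans hcs⟩⟩
    have hli := hgp _ (hinj I hI (hcompl I hI))
    have hspan := hli.span_eq_top_of_card_eq_finrank' (by simp [hE])
    obtain ⟨l, hl⟩ := (Submodule.mem_span_range_iff_exists_fun ℝ).mp
      (hspan ▸ Submodule.mem_top : x ∈ _)
    -- Expanding one factor of ⟨x, x⟩ = 1 in the basis, on which x takes the constant value c, shows
    -- that the coefficient sum is 1/c ≥ 1/s.
    have hone : 1 = c * ∑ i, l i := by
      have : inner ℝ x x = c * ∑ i, l i := by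
        nth_rw 1 [← hl]
        rw [sum_inner, Finset.mul_sum]
        refine Finset.sum_congr rfl fun i _ => ?_
        rw [real_inner_smul_left, Function.comp_apply, hSc _ (hIS (hrange I hI _ i)), mul_comm]
      rw [← this, real_inner_self_eq_norm_sq, hx, one_pow]
    refine exists_near_hyperplane hE _ l hs ?_ ?_
    · intro h
      rw [h, mul_zero] at hone
      exact one_ne_zero hone
    · have hxs : ‖∑ i, l i • (a (finSumEquivOfFinset hI (hcompl I hI) (Sum.inl i)))‖ = 1 := by
        rw [← hx, ← hl]; rfl
      rw [hxs]
      calc (1 : ℝ) = c * ∑ i, l i := hone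
        _ ≤ c * |∑ i, l i| := by gcongr; exact le_abs_self _
        _ ≤ s * |∑ i, l i| := by gcongr
  · obtain ⟨p, hp, hmin⟩ := exists_min_norm_point a
    have hp0 : p ≠ 0 := fun h => h0 (h ▸ hp)
    have hps : ‖p‖ ≤ s := by
      obtain ⟨i, hi⟩ := h2 (-(‖p‖⁻¹ • p)) (by rw [norm_neg]; exact norm_smul_inv_norm hp0)
      rw [inner_neg_right, inner_smul_right, neg_le_neg_iff] at hi
      have hpp : 0 < ‖p‖ := norm_pos_iff.mpr hp0
      calc ‖p‖ = ‖p‖⁻¹ * ‖p‖ ^ 2 := by field_simp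
        _ ≤ ‖p‖⁻¹ * inner ℝ (a i) p := by gcongr; exact hmin i
        _ ≤ s := hi
    obtain ⟨T, hT, w, hw0, hwT, hw1, hwp⟩ := exists_small_support a hp hp0 hmin
    rw [hE] at hT
    -- The support may have fewer than m rows; pad it with rows of weight zero.
    obtain ⟨I, hTI, -, hI⟩ := Finset.exists_subsuperset_card_eq (Finset.subset_univ T) hT
      (by simp; omega)
    have hwI1 : ∑ i, w (finSumEquivOfFinset hI (hcompl I hI) (Sum.inl i)) = 1 := by
      rw [← hw1, Finset.sum_subset hTI fun i _ hi => hwT i hi]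
      conv_rhs => rw [← himage I hI (hcompl I hI)]
      rw [Finset.sum_image fun i _ j _ h => hinj I hI _ h]
    have hwIp : ∑ i, w (finSumEquivOfFinset hI (hcompl I hI) (Sum.inl i)) •
        a (finSumEquivOfFinset hI (hcompl I hI) (Sum.inl i)) = p := by
      rw [← hwp, Finset.sum_subset hTI fun i _ hi => by rw [hwT i hi, zero_smul]]
      conv_rhs => rw [← himage I hI (hcompl I hI)]
      rw [Finset.sum_image fun i _ j _ h => hinj I hI _ h]
    refine ⟨I, hI, hcompl I hI, ?_, Or.inr
      ⟨fun i => w (finSumEquivOfFinset hI (hcompl I hI) (Sum.inl i)), ⟨fun i => hw0 _, hwI1⟩,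
        fun i => by rw [hwIp]; exact hmin _,
        fun j => by rw [hwIp]; exact (sq_nonneg _).trans (hmin _)⟩⟩
    refine exists_near_hyperplane hE _
      (fun i => w (finSumEquivOfFinset hI (hcompl I hI) (Sum.inl i))) hs ?_ ?_
    · rw [hwI1]; exact one_ne_zero
    · rw [hwIp, hwI1, abs_one, mul_one]; exact hps

end Deterministic

/-! ### Independence, measurability and the union bound. -/

section ProductMeasures

variable {E : Type*} [NormedAddCommGroup E] [InnerProductSpace ℝ E] [FiniteDimensional ℝ E]
  [MeasurableSpace E] [BorelSpace E]

theorem measurePreserving_comp_injective {ι κ X : Type*} [Fintype ι] [Fintype κ]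
    [MeasurableSpace X] (ν : Measure X) [IsProbabilityMeasure ν] {f : κ → ι}
    (hf : Function.Injective f) :
    MeasurePreserving (fun a : ι → X => a ∘ f) (Measure.pi fun _ => ν) (Measure.pi fun _ => ν) := by
  refine ⟨measurable_pi_lambda _ fun k => measurable_pi_apply _, ?_⟩
  have h1 : iIndepFun (fun (i : ι) (a : ι → X) => a i) (Measure.pi fun _ => ν) :=
    iIndepFun_pi (X := fun _ x => x) fun _ => aemeasurable_id
  have h2 := (iIndepFun_iff_map_fun_eq_pi_map
    (fun i => (measurable_pi_apply (f i)).aemeasurable)).mp (h1.precomp hf)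
  refine Eq.trans ?_ (h2.trans ?_)
  · rfl
  · congr 1
    ext1 k
    exact (measurePreserving_eval (fun _ : ι => ν) (f k)).map_eq

/-- Projection along a compact factor is a closed map. This makes the events that quantify over unit
vectors or simplex weights measurable. -/
theorem isClosed_setOf_exists_mem_compact {K Y : Type*} [TopologicalSpace K] [TopologicalSpace Y]
    {s : Set K} (hs : IsCompact s) {p : K → Y → Prop} (hp : IsClosed {z : K × Y | p z.1 z.2}) :
    IsClosed {y | ∃ x ∈ s, p x y} := by
  have : CompactSpace s := isCompact_iff_compactSpace.mp hs
  have h1 : IsClosed {z : s × Y | p z.1 z.2} :=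
    hp.preimage (f := fun z : s × Y => ((z.1 : K), z.2)) (by fun_prop)
  convert isClosedMap_snd_of_compactSpace _ h1 using 1
  ext y
  simp

/-- Fewer than `finrank` vectors lie in a common hyperplane, which is null, so a further independent
vector almost surely avoids their span. -/
theorem ae_linearIndependent_pi (ν : Measure E) [IsProbabilityMeasure ν]
    (hν : ∀ u : E, ‖u‖ = 1 → ν {a | inner ℝ a u = 0} = 0) :
    ∀ k ≤ Module.finrank ℝ E,
      ∀ᵐ b ∂(Measure.pi fun _ : Fin k => ν), LinearIndependent ℝ b := by
  intro k
  induction k with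
  | zero => exact fun _ => Filter.Eventually.of_forall fun b => linearIndependent_empty_type
  | succ k ih =>
    intro hk
    have hmp := measurePreserving_piFinSuccAbove (fun _ : Fin (k + 1) => ν) 0
    have hmeas : MeasurableSet {b : Fin (k + 1) → E | LinearIndependent ℝ b} :=
      isOpen_setOfPred_linearIndependent.measurableSet
    have hswap := (Measure.measurePreserving_swap (μ := Measure.pi fun _ : Fin k => ν) (ν := ν))
    have hmp' := hmp.symm.comp hswap
    rw [← hmp'.map_eq, ae_map_iff hmp'.measurable.aemeasurable hmeas]
    refine (Measure.ae_prod_iff_ae_ae (hmp'.measurable hmeas)).mpr ?_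
    filter_upwards [ih (by omega)] with y hy
    obtain ⟨u, hu1, hu⟩ := exists_unit_orthogonal_of_card_lt (E := E) Finset.univ y
      (by simpa using hk)
    rw [ae_iff]
    refine measure_mono_null (fun x hx => ?_) (hν u hu1)
    by_contra hxu
    refine hx ?_
    have : (MeasurableEquiv.piFinSuccAbove (fun _ : Fin (k + 1) => E) 0).symm (x, y) =
        Fin.insertNth 0 x y := rfl
    simp only [Function.comp_apply, Prod.swap_prod_mk, this, Fin.insertNth_zero]
    rw [linearIndependent_finCons]
    refine ⟨hy, fun hmem => hxu ?_⟩
    change inner ℝ x u = 0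
    exact inner_eq_zero_of_mem_span_range (fun i => hu i (Finset.mem_univ i)) hmem

omit [MeasurableSpace E] [BorelSpace E] in
theorem isClosed_near_hyperplane {m : ℕ} (k : Fin m) (R : ℝ) :
    IsClosed {b : Fin m → E | ∃ u : E, ‖u‖ = 1 ∧
      (∀ i, i ≠ k → inner ℝ (b i) u = 0) ∧ |inner ℝ (b k) u| ≤ R} := by
  have h := isClosed_setOf_exists_mem_compact (isCompact_sphere (0 : E) 1)
    (p := fun (u : E) (b : Fin m → E) =>
      (∀ i, i ≠ k → inner ℝ (b i) u = 0) ∧ |inner ℝ (b k) u| ≤ R) (by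
    refine IsClosed.and ?_ (isClosed_le (by fun_prop) continuous_const)
    simp only [Set.ofPred_forall]
    exact isClosed_iInter fun i => isClosed_iInter fun _ =>
      isClosed_eq (by fun_prop) continuous_const)
  simpa only [mem_sphere_zero_iff_norm] using h

omit [MeasurableSpace E] [BorelSpace E] in
theorem isClosed_centre (m r : ℕ) (s : ℝ) :
    IsClosed {z : (Fin m → E) × (Fin r → E) |
      (∃ d ∈ Set.Icc 0 s, ∃ x : E, ‖x‖ = 1 ∧ (∀ i, inner ℝ (z.1 i) x = d) ∧
        ∀ j, inner ℝ (z.2 j) x ≤ s) ∨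
      ∃ w ∈ stdSimplex ℝ (Fin m),
        (∀ i, ‖∑ k, w k • z.1 k‖ ^ 2 ≤ inner ℝ (z.1 i) (∑ k, w k • z.1 k)) ∧
        ∀ j, 0 ≤ inner ℝ (z.2 j) (∑ k, w k • z.1 k)} := by
  rw [Set.ofPred_or]
  refine IsClosed.union ?_ ?_
  · have h := isClosed_setOf_exists_mem_compact
      ((isCompact_Icc (a := (0 : ℝ)) (b := s)).prod (isCompact_sphere (0 : E) 1))
      (p := fun (y : ℝ × E) (z : (Fin m → E) × (Fin r → E)) =>
        (∀ i, inner ℝ (z.1 i) y.2 = y.1) ∧ ∀ j, inner ℝ (z.2 j) y.2 ≤ s) (by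
      refine IsClosed.and ?_ ?_
      · simp only [Set.ofPred_forall]
        exact isClosed_iInter fun i => isClosed_eq (by fun_prop) (by fun_prop)
      · simp only [Set.ofPred_forall]
        exact isClosed_iInter fun i => isClosed_le (by fun_prop) (by fun_prop))
    convert h using 1
    ext z
    simp only [Set.mem_ofPred_eq, Set.mem_prod, mem_sphere_zero_iff_norm]
    constructor
    · rintro ⟨d, hd, x, hx, h⟩
      exact ⟨(d, x), ⟨hd, hx⟩, h⟩
    · rintro ⟨⟨d, x⟩, ⟨hd, hx⟩, h⟩
      exact ⟨d, hd, x, hx, h⟩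
  · refine isClosed_setOf_exists_mem_compact (isCompact_stdSimplex ℝ (Fin m))
      (p := fun (w : Fin m → ℝ) (z : (Fin m → E) × (Fin r → E)) =>
        (∀ i, ‖∑ k, w k • z.1 k‖ ^ 2 ≤ inner ℝ (z.1 i) (∑ k, w k • z.1 k)) ∧
        ∀ j, 0 ≤ inner ℝ (z.2 j) (∑ k, w k • z.1 k)) ?_
    refine IsClosed.and ?_ ?_
    · simp only [Set.ofPred_forall]
      exact isClosed_iInter fun i => isClosed_le (by fun_prop) (by fun_prop)
    · simp only [Set.ofPred_forall]
      exact isClosed_iInter fun i => isClosed_le (by fun_prop) (by fun_prop)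

/-- A random family of `finrank` vectors is rarely linearly independent with one vector close to
a hyperplane through the others. -/
theorem measure_near_hyperplane_le {m : ℕ} (hE : Module.finrank ℝ E = m) (ν : Measure E)
    [IsProbabilityMeasure ν] {R : ℝ} {κ : ENNReal}
    (hν : ∀ u : E, ‖u‖ = 1 → ν {a | |inner ℝ a u| ≤ R} ≤ κ) :
    (Measure.pi fun _ : Fin m => ν) {b | LinearIndependent ℝ b ∧ ∃ k, ∃ u : E, ‖u‖ = 1 ∧
      (∀ i, i ≠ k → inner ℝ (b i) u = 0) ∧ |inner ℝ (b k) u| ≤ R} ≤ m * κ := by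
  have hset : {b : Fin m → E | LinearIndependent ℝ b ∧ ∃ k, ∃ u : E, ‖u‖ = 1 ∧
      (∀ i, i ≠ k → inner ℝ (b i) u = 0) ∧ |inner ℝ (b k) u| ≤ R} =
      ⋃ k, {b | LinearIndependent ℝ b} ∩ {b | ∃ u : E, ‖u‖ = 1 ∧
        (∀ i, i ≠ k → inner ℝ (b i) u = 0) ∧ |inner ℝ (b k) u| ≤ R} := by
    ext b
    simp
  rw [hset]
  refine (measure_iUnion_fintype_le _ _).trans ?_
  suffices hk : ∀ k : Fin m, (Measure.pi fun _ : Fin m => ν)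
      ({b | LinearIndependent ℝ b} ∩ {b | ∃ u : E, ‖u‖ = 1 ∧
        (∀ i, i ≠ k → inner ℝ (b i) u = 0) ∧ |inner ℝ (b k) u| ≤ R}) ≤ κ by
    simpa using Finset.sum_le_sum fun k (_ : k ∈ Finset.univ) => hk k
  intro k
  obtain ⟨d, rfl⟩ : ∃ d, m = d + 1 := ⟨m - 1, by have := k.2; omega⟩
  set S := {b : Fin (d + 1) → E | LinearIndependent ℝ b} ∩ {b | ∃ u : E, ‖u‖ = 1 ∧
        (∀ i, i ≠ k → inner ℝ (b i) u = 0) ∧ |inner ℝ (b k) u| ≤ R} with hS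
  have hmeas : MeasurableSet S :=
    isOpen_setOfPred_linearIndependent.measurableSet.inter
      (isClosed_near_hyperplane k R).measurableSet
  have hmp := measurePreserving_piFinSuccAbove (fun _ : Fin (d + 1) => ν) k
  have hsymm : ∀ x y, (MeasurableEquiv.piFinSuccAbove (fun _ : Fin (d + 1) => E) k).symm (x, y) =
      k.insertNth x y := fun _ _ => rfl
  rw [← hmp.symm.measure_preimage hmeas.nullMeasurableSet,
    Measure.prod_apply_symm (hmp.symm.measurable hmeas)]
  suffices hy : ∀ y : Fin d → E, ν ((fun x => (x, y)) ⁻¹'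
      ((MeasurableEquiv.piFinSuccAbove (fun _ : Fin (d + 1) => E) k).symm ⁻¹' S)) ≤ κ by
    calc _ ≤ ∫⁻ _y, κ ∂(Measure.pi fun _ : Fin d => ν) := lintegral_mono hy
      _ = κ := by simp
  intro y
  have hmem : ∀ x, x ∈ (fun x => (x, y)) ⁻¹'
      ((MeasurableEquiv.piFinSuccAbove (fun _ : Fin (d + 1) => E) k).symm ⁻¹' S) →
      LinearIndependent ℝ y ∧ ∃ u : E, ‖u‖ = 1 ∧ (∀ i, inner ℝ (y i) u = 0) ∧
        |inner ℝ x u| ≤ R := by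
    rintro x ⟨hli, u, hu, hyu, hxu⟩
    rw [hsymm] at hli hyu hxu
    refine ⟨?_, u, hu, fun i => ?_, by simpa using hxu⟩
    · have := hli.comp _ (Fin.succAbove_right_injective (p := k))
      convert this using 1
      ext1 i
      simp
    · simpa using hyu (k.succAbove i) (Fin.succAbove_ne k i)
  rcases Set.eq_empty_or_nonempty ((fun x => (x, y)) ⁻¹'
      ((MeasurableEquiv.piFinSuccAbove (fun _ : Fin (d + 1) => E) k).symm ⁻¹' S)) with h | h
  · rw [h, measure_empty]; exact zero_le
  obtain ⟨x0, hx0⟩ := h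
  -- The independent vectors y have a one-dimensional orthogonal complement, so every admissible u
  -- is ±u0 and the whole section lies in one slab.
  obtain ⟨hli, u0, hu0, hyu0, -⟩ := hmem x0 hx0
  refine (measure_mono fun x hx => ?_).trans (hν u0 hu0)
  obtain ⟨-, u, hu, hyu, hxu⟩ := hmem x hx
  have hmemorth : ∀ v : E, (∀ i, inner ℝ (y i) v = 0) →
      v ∈ (Submodule.span ℝ (Set.range y))ᗮ := by
    intro v hv
    rw [Submodule.mem_orthogonal]
    exact fun z hz => inner_eq_zero_of_mem_span_range hv hz
  have hfin : Module.finrank ℝ (Submodule.span ℝ (Set.range y))ᗮ = 1 := by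
    have h1 := Submodule.finrank_add_finrank_orthogonal (Submodule.span ℝ (Set.range y))
    rw [finrank_span_eq_card hli, Fintype.card_fin, hE] at h1
    omega
  obtain ⟨c, hc⟩ := (finrank_eq_one_iff_of_nonzero'
    (⟨u0, hmemorth u0 hyu0⟩ : (Submodule.span ℝ (Set.range y))ᗮ) (by
      intro h
      have : u0 = 0 := congrArg Subtype.val h
      simp [this] at hu0)).mp hfin ⟨u, hmemorth u hyu⟩
  have hc' : c • u0 = u := congrArg Subtype.val hc
  have hc1 : |c| = 1 := by
    have := congrArg norm hc'
    rwa [norm_smul, hu0, hu, mul_one, Real.norm_eq_abs] at this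
  change |inner ℝ x u0| ≤ R
  rwa [← hc', inner_smul_right, abs_mul, hc1, one_mul] at hxu

omit [BorelSpace E] [FiniteDimensional ℝ E] in
theorem measure_forall_inner_le {r : ℕ} (ν : Measure E) [IsProbabilityMeasure ν] {s : ℝ}
    {q : ENNReal} (hq : ∀ x : E, ‖x‖ = 1 → ν {a | inner ℝ a x ≤ s} ≤ q) {x : E} (hx : ‖x‖ = 1) :
    (Measure.pi fun _ : Fin r => ν) {c | ∀ j, inner ℝ (c j) x ≤ s} ≤ q ^ r := by
  have : {c : Fin r → E | ∀ j, inner ℝ (c j) x ≤ s} =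
      Set.univ.pi fun _ => {a | inner ℝ a x ≤ s} := by ext; simp
  rw [this, Measure.pi_pi]
  simpa using Finset.prod_le_prod' (s := (Finset.univ : Finset (Fin r))) fun _ _ => hq x hx

omit [BorelSpace E] in
/-- The two alternatives for the centre determined by a linearly independent block have small
probability of being avoided by the remaining vectors. -/
theorem measure_centre_le {m r : ℕ} (hE : Module.finrank ℝ E = m) (ν : Measure E)
    [IsProbabilityMeasure ν] {s : ℝ} (hs : 0 ≤ s) {q : ENNReal}
    (hq : ∀ x : E, ‖x‖ = 1 → ν {a | inner ℝ a x ≤ s} ≤ q)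
    {b : Fin m → E} (hb : LinearIndependent ℝ b) :
    (Measure.pi fun _ : Fin r => ν) {c | (∃ d ∈ Set.Icc 0 s, ∃ x : E, ‖x‖ = 1 ∧
        (∀ i, inner ℝ (b i) x = d) ∧ ∀ j, inner ℝ (c j) x ≤ s) ∨
      ∃ w ∈ stdSimplex ℝ (Fin m), (∀ i, ‖∑ k, w k • b k‖ ^ 2 ≤ inner ℝ (b i) (∑ k, w k • b k)) ∧
        ∀ j, 0 ≤ inner ℝ (c j) (∑ k, w k • b k)} ≤ 2 * q ^ r := by
  rw [two_mul, Set.ofPred_or]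
  refine (measure_union_le _ _).trans (add_le_add ?_ ?_)
  · rcases Set.eq_empty_or_nonempty {c : Fin r → E | ∃ d ∈ Set.Icc 0 s, ∃ x : E, ‖x‖ = 1 ∧
        (∀ i, inner ℝ (b i) x = d) ∧ ∀ j, inner ℝ (c j) x ≤ s} with h | h
    · rw [h, measure_empty]; exact zero_le
    obtain ⟨c0, d0, hd0, x0, hx0, hb0, -⟩ := h
    refine (measure_mono ?_).trans (measure_forall_inner_le ν hq hx0)
    rintro c ⟨d, hd, x, hx, hbx, hc⟩
    have hspan := hb.span_eq_top_of_card_eq_finrank' (by simp [hE])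
    have horth : ∀ y : E, (∀ i, inner ℝ (b i) y = 0) → y = 0 := by
      intro y hy
      have := inner_eq_zero_of_mem_span_range hy (hspan ▸ Submodule.mem_top : y ∈ _)
      rwa [inner_self_eq_zero] at this
    -- Both sides have product d·d0 with each b i, and the b i span. Comparing norms then gives d =
    -- d0.
    have hprop : d0 • x = d • x0 := by
      rw [← sub_eq_zero]
      apply horth
      intro i
      rw [inner_sub_right, inner_smul_right, inner_smul_right, hbx, hb0]
      ring
    have hdpos : d0 ≠ 0 := by
      rintro rfl
      have := horth x0 hb0
      simp [this] at hx0
    have hdd : d0 = d := by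
      have := congrArg norm hprop
      rwa [norm_smul, norm_smul, hx, hx0, Real.norm_of_nonneg hd0.1, Real.norm_of_nonneg hd.1,
        mul_one, mul_one] at this
    have hxx : x = x0 := by
      rw [← hdd] at hprop
      exact smul_right_injective E hdpos hprop
    exact hxx ▸ hc
  · rcases Set.eq_empty_or_nonempty {c : Fin r → E | ∃ w ∈ stdSimplex ℝ (Fin m),
        (∀ i, ‖∑ k, w k • b k‖ ^ 2 ≤ inner ℝ (b i) (∑ k, w k • b k)) ∧
        ∀ j, 0 ≤ inner ℝ (c j) (∑ k, w k • b k)} with h | h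
    · rw [h, measure_empty]; exact zero_le
    obtain ⟨c0, w0, hw0, hb0, -⟩ := h
    set p := ∑ k, w0 k • b k with hp
    have hp0 : p ≠ 0 := by
      intro h
      have hz := Fintype.linearIndependent_iff.mp hb w0 h
      have := hw0.2
      simp [hz] at this
    refine (measure_mono ?_).trans (measure_forall_inner_le ν hq (x := -(‖p‖⁻¹ • p))
      (by rw [norm_neg]; exact norm_smul_inv_norm hp0))
    rintro c ⟨w, hw, hbw, hc⟩ j
    -- Applied both ways, this gives ‖p‖² ≤ ⟨p', p⟩ and ‖p'‖² ≤ ⟨p, p'⟩ for two minimal points,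
    -- hence ‖p' - p‖² ≤ 0.
    have key : ∀ v z : Fin m → ℝ, v ∈ stdSimplex ℝ (Fin m) →
        (∀ i, ‖∑ k, z k • b k‖ ^ 2 ≤ inner ℝ (b i) (∑ k, z k • b k)) →
        ‖∑ k, z k • b k‖ ^ 2 ≤ inner ℝ (∑ k, v k • b k) (∑ k, z k • b k) := by
      intro v z hv hz
      rw [sum_inner]
      calc ‖∑ k, z k • b k‖ ^ 2 = ∑ i, v i * ‖∑ k, z k • b k‖ ^ 2 := by
            rw [← Finset.sum_mul, hv.2, one_mul]
        _ ≤ ∑ i, inner ℝ (v i • b i) (∑ k, z k • b k) := by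
            refine Finset.sum_le_sum fun i _ => ?_
            rw [real_inner_smul_left]
            exact mul_le_mul_of_nonneg_left (hz i) (hv.1 i)
    have h1 := key w w0 hw hb0
    have h2 := key w0 w hw0 hbw
    have heq : ∑ k, w k • b k = p := by
      rw [← sub_eq_zero, ← norm_eq_zero, ← sq_eq_zero_iff]
      refine le_antisymm ?_ (sq_nonneg _)
      rw [norm_sub_sq_real]
      rw [real_inner_comm] at h2
      linarith
    have := hc j
    rw [heq] at this
    rw [inner_neg_right, inner_smul_right]
    have : 0 ≤ ‖p‖⁻¹ * inner ℝ (c j) p := by positivity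
    linarith

theorem measurableSet_badBlocks (m r : ℕ) (s : ℝ) :
    MeasurableSet {z : (Fin m → E) × (Fin r → E) | LinearIndependent ℝ z.1 ∧
      BadBlocks s z.1 z.2} := by
  have hset : {z : (Fin m → E) × (Fin r → E) | LinearIndependent ℝ z.1 ∧
      BadBlocks s z.1 z.2} = (Prod.fst ⁻¹' ({b | LinearIndependent ℝ b} ∩
        ⋃ k, {b : Fin m → E | ∃ u : E, ‖u‖ = 1 ∧ (∀ i, i ≠ k → inner ℝ (b i) u = 0) ∧
          |inner ℝ (b k) u| ≤ m * s})) ∩ {z : (Fin m → E) × (Fin r → E) |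
      (∃ d ∈ Set.Icc 0 s, ∃ x : E, ‖x‖ = 1 ∧ (∀ i, inner ℝ (z.1 i) x = d) ∧
        ∀ j, inner ℝ (z.2 j) x ≤ s) ∨
      ∃ w ∈ stdSimplex ℝ (Fin m),
        (∀ i, ‖∑ k, w k • z.1 k‖ ^ 2 ≤ inner ℝ (z.1 i) (∑ k, w k • z.1 k)) ∧
        ∀ j, 0 ≤ inner ℝ (z.2 j) (∑ k, w k • z.1 k)} := by
    ext z
    constructor
    · rintro ⟨h1, h2, h3⟩
      exact ⟨⟨h1, Set.mem_iUnion.mpr h2⟩, h3⟩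
    · rintro ⟨⟨h1, h2⟩, h3⟩
      exact ⟨h1, Set.mem_iUnion.mp h2, h3⟩
  rw [hset]
  exact (measurable_fst (isOpen_setOfPred_linearIndependent.measurableSet.inter
    (MeasurableSet.iUnion fun k => (isClosed_near_hyperplane k _).measurableSet))).inter
    (isClosed_centre m r s).measurableSet

/-- The near-hyperplane defect concerns b only, and the centre bound is uniform over independent b,
so Fubini multiplies the two estimates. -/
theorem measure_badBlocks_le {m r : ℕ} (hE : Module.finrank ℝ E = m) (ν : Measure E)
    [IsProbabilityMeasure ν] {s : ℝ} (hs : 0 ≤ s) {κ q : ENNReal}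
    (hκ : ∀ u : E, ‖u‖ = 1 → ν {a | |inner ℝ a u| ≤ m * s} ≤ κ)
    (hq : ∀ x : E, ‖x‖ = 1 → ν {a | inner ℝ a x ≤ s} ≤ q) :
    ((Measure.pi fun _ : Fin m => ν).prod (Measure.pi fun _ : Fin r => ν))
      {z | LinearIndependent ℝ z.1 ∧ BadBlocks s z.1 z.2} ≤ m * κ * (2 * q ^ r) := by
  classical
  set L := {b : Fin m → E | LinearIndependent ℝ b ∧ ∃ k, ∃ u : E, ‖u‖ = 1 ∧
      (∀ i, i ≠ k → inner ℝ (b i) u = 0) ∧ |inner ℝ (b k) u| ≤ m * s} with hL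
  rw [Measure.prod_apply (measurableSet_badBlocks m r s)]
  calc _ ≤ ∫⁻ b, L.indicator (fun _ => 2 * q ^ r) b ∂(Measure.pi fun _ : Fin m => ν) := by
        refine lintegral_mono fun b => ?_
        by_cases hb : b ∈ L
        · rw [Set.indicator_of_mem hb]
          exact (measure_mono fun c hc => hc.2.centre).trans (measure_centre_le hE ν hs hq hb.1)
        · rw [Set.indicator_of_notMem hb, nonpos_iff_eq_zero]
          refine measure_mono_null (fun c hc => ?_) measure_empty
          exact hb ⟨hc.1, hc.2.near⟩
    _ ≤ 2 * q ^ r * (Measure.pi fun _ : Fin m => ν) L := lintegral_indicator_const_le _ _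
    _ ≤ 2 * q ^ r * (m * κ) := by
        gcongr
        exact measure_near_hyperplane_le hE ν hκ
    _ = m * κ * (2 * q ^ r) := mul_comm _ _

theorem measure_pi_le {n m r : ℕ} (hE : Module.finrank ℝ E = m) (hm : 0 < m) (hnr : n = m + r)
    (ν : Measure E) [IsProbabilityMeasure ν] {s : ℝ} (hs : 0 ≤ s) {κ q : ENNReal}
    (h0 : ∀ u : E, ‖u‖ = 1 → ν {a | inner ℝ a u = 0} = 0)
    (hκ : ∀ u : E, ‖u‖ = 1 → ν {a | |inner ℝ a u| ≤ m * s} ≤ κ)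
    (hq : ∀ x : E, ‖x‖ = 1 → ν {a | inner ℝ a x ≤ s} ≤ q) :
    (Measure.pi fun _ : Fin n => ν) {a | (∃ x : E, ‖x‖ = 1 ∧ ∀ i, inner ℝ (a i) x ≤ s) ∧
      ∀ x : E, ‖x‖ = 1 → ∃ i, -s ≤ inner ℝ (a i) x} ≤
      n.choose m * (m * κ * (2 * q ^ r)) := by
  classical
  set μ := Measure.pi fun _ : Fin n => ν with hμ
  have hgp : ∀ᵐ a ∂μ, ∀ f : Fin m → Fin n, Function.Injective f →
      LinearIndependent ℝ (a ∘ f) := by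
    rw [ae_all_iff]
    intro f
    by_cases hf : Function.Injective f
    · filter_upwards [(measurePreserving_comp_injective ν hf).quasiMeasurePreserving.ae
        (ae_linearIndependent_pi ν h0 m hE.ge)] with a ha _ using ha
    · exact Filter.Eventually.of_forall fun a h => absurd h hf
  have hcompl : ∀ I : Finset (Fin n), I.card = m → Iᶜ.card = r := fun I hI => by
    rw [Finset.card_compl, Fintype.card_fin, hI]; omega
  let T : {I : Finset (Fin n) // I.card = m} → Set (Fin n → E) := fun I =>
    {a | LinearIndependent ℝ
        (fun i => a (finSumEquivOfFinset I.2 (hcompl _ I.2) (Sum.inl i))) ∧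
      BadBlocks s (fun i => a (finSumEquivOfFinset I.2 (hcompl _ I.2) (Sum.inl i)))
        (fun j => a (finSumEquivOfFinset I.2 (hcompl _ I.2) (Sum.inr j)))}
  have hT : ∀ I, μ (T I) ≤ m * κ * (2 * q ^ r) := by
    intro I
    refine le_of_eq_of_le ?_ (measure_badBlocks_le (r := r) hE ν hs hκ hq)
    have hmp := (measurePreserving_sumPiEquivProdPi
      (fun _ : Fin m ⊕ Fin r => ν)).comp (measurePreserving_comp_injective ν
        (finSumEquivOfFinset I.2 (hcompl _ I.2)).injective)
    rw [← hmp.measure_preimage (measurableSet_badBlocks m r s).nullMeasurableSet]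
    rfl
  calc _ ≤ μ (⋃ I, T I) := by
        apply measure_mono_ae
        filter_upwards [hgp] with a ha hmem
        obtain ⟨I, hI, hI', hbad⟩ := exists_badBlocks hE hm hnr a ha hs hmem.1 hmem.2
        refine Set.mem_iUnion.mpr ⟨⟨I, hI⟩, ha _ ?_, hbad⟩
        exact (Equiv.injective _).comp Sum.inl_injective
    _ ≤ ∑ I, μ (T I) := measure_iUnion_fintype_le _ _
    _ ≤ ∑ _I : {I : Finset (Fin n) // I.card = m}, m * κ * (2 * q ^ r) :=
        Finset.sum_le_sum fun I _ => hT I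
    _ = n.choose m * (m * κ * (2 * q ^ r)) := by
        rw [Finset.sum_const, nsmul_eq_mul, Finset.card_univ, Fintype.card_finset_len,
          Fintype.card_fin]

end ProductMeasures

/-! ### Polar coordinates for rotation-invariant densities. -/

section Radial

open scoped ENNReal

theorem lintegral_fun_norm_addHaar {F : Type*} [NormedAddCommGroup F] [NormedSpace ℝ F]
    [Nontrivial F] [FiniteDimensional ℝ F] [MeasurableSpace F] [BorelSpace F] (μ : Measure F)
    [μ.IsAddHaarMeasure] {f : ℝ → ℝ≥0∞} (hf : Measurable f) :
    ∫⁻ x, f ‖x‖ ∂μ = μ.toSphere Set.univ *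
      ∫⁻ r in Set.Ioi (0 : ℝ), ENNReal.ofReal (r ^ (Module.finrank ℝ F - 1)) * f r := by
  calc
    ∫⁻ x, f ‖x‖ ∂μ = ∫⁻ x : ({(0)}ᶜ : Set F), f ‖x.1‖ ∂(μ.comap (↑)) := by
      rw [lintegral_subtype_comap (measurableSet_singleton _).compl fun x => f ‖x‖,
        restrict_compl_singleton]
    _ = ∫⁻ x, f x.2 ∂μ.toSphere.prod (.volumeIoiPow (Module.finrank ℝ F - 1)) := by
      simpa using μ.measurePreserving_homeomorphUnitSphereProd.lintegral_comp_emb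
        (Homeomorph.measurableEmbedding _) (fun p => f p.2)
    _ = μ.toSphere Set.univ *
        ∫⁻ x : Set.Ioi (0 : ℝ), f x ∂.volumeIoiPow (Module.finrank ℝ F - 1) := by
      rw [lintegral_prod _ (by fun_prop)]
      simp [mul_comm]
    _ = _ := by
      rw [Measure.volumeIoiPow, lintegral_withDensity_eq_lintegral_mul _ (by fun_prop)
        (by fun_prop)]
      congr 1
      exact lintegral_subtype_comap measurableSet_Ioi
        fun r : ℝ => ENNReal.ofReal (r ^ (Module.finrank ℝ F - 1)) * f r

/-- Splitting off the first coordinate of a Euclidean space. -/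
theorem measurePreserving_euclidean_cons (d : ℕ) :
    MeasurePreserving (fun x : EuclideanSpace ℝ (Fin (d + 1)) =>
      (x 0, (WithLp.toLp 2 fun i : Fin d => x i.succ : EuclideanSpace ℝ (Fin d)))) := by
  have h1 := PiLp.volume_preserving_ofLp (Fin (d + 1))
  have h2 := volume_preserving_piFinSuccAbove (fun _ : Fin (d + 1) => ℝ) 0
  have h3 := (MeasurePreserving.id (volume : Measure ℝ)).prod
    (PiLp.volume_preserving_toLp (Fin d))
  exact (h3.comp h2).comp h1

theorem norm_euclidean_cons (d : ℕ) (x : EuclideanSpace ℝ (Fin (d + 1))) :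
    ‖x‖ = √(x 0 ^ 2 +
      ‖(WithLp.toLp 2 fun i : Fin d => x i.succ : EuclideanSpace ℝ (Fin d))‖ ^ 2) := by
  rw [EuclideanSpace.norm_eq, EuclideanSpace.norm_sq_eq, Fin.sum_univ_succ]
  simp

/-- The (unnormalised) law of the cosine of the angle to a fixed direction. -/
noncomputable def cosineMass (k : ℕ) (T : Set ℝ) : ℝ≥0∞ :=
  ∫⁻ φ in Set.Ioo 0 Real.pi, T.indicator 1 (Real.cos φ) * ENNReal.ofReal (Real.sin φ ^ k)

/-- Substitute h = ρ cos φ, r = ρ sin φ with φ in (0, π): r^k and the Jacobian ρ combine to ρ^(k+1)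
sin^k φ, and the integral factors. -/
theorem lintegral_halfPlane_polar (k : ℕ) {w : ℝ → ℝ≥0∞} (hw : Measurable w) {T : Set ℝ}
    (hT : MeasurableSet T) :
    ∫⁻ h : ℝ, ∫⁻ r in Set.Ioi (0 : ℝ), ENNReal.ofReal (r ^ k) *
      (w √(h ^ 2 + r ^ 2) * T.indicator 1 ((√(h ^ 2 + r ^ 2))⁻¹ * h)) =
    (∫⁻ ρ in Set.Ioi (0 : ℝ), ENNReal.ofReal (ρ ^ (k + 1)) * w ρ) * cosineMass k T := by
  have hind : Measurable (T.indicator (1 : ℝ → ℝ≥0∞)) := measurable_one.indicator hT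
  set G : ℝ × ℝ → ℝ≥0∞ := fun p => (Set.Ioi (0 : ℝ)).indicator 1 p.2 *
    (ENNReal.ofReal (p.2 ^ k) * (w √(p.1 ^ 2 + p.2 ^ 2) *
      T.indicator 1 ((√(p.1 ^ 2 + p.2 ^ 2))⁻¹ * p.1))) with hG
  have hind0 : Measurable ((Set.Ioi (0 : ℝ)).indicator (1 : ℝ → ℝ≥0∞)) :=
    measurable_one.indicator measurableSet_Ioi
  have hGm : Measurable G := by
    rw [hG]
    fun_prop
  have h1 : ∫⁻ h : ℝ, ∫⁻ r in Set.Ioi (0 : ℝ), ENNReal.ofReal (r ^ k) *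
      (w √(h ^ 2 + r ^ 2) * T.indicator 1 ((√(h ^ 2 + r ^ 2))⁻¹ * h)) = ∫⁻ p : ℝ × ℝ, G p := by
    rw [Measure.volume_eq_prod, lintegral_prod _ hGm.aemeasurable]
    refine lintegral_congr fun h => ?_
    rw [← lintegral_indicator measurableSet_Ioi]
    refine lintegral_congr fun r => ?_
    by_cases hr : r ∈ Set.Ioi (0 : ℝ) <;> simp [hG, hr]
  have h2 : ∀ p ∈ polarCoord.target, ENNReal.ofReal p.1 • G (polarCoord.symm p) =
      (ENNReal.ofReal (p.1 ^ (k + 1)) * w p.1) *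
      ((Set.Ioo 0 Real.pi).indicator (fun φ => T.indicator 1 (Real.cos φ) *
        ENNReal.ofReal (Real.sin φ ^ k)) p.2) := by
    rintro ⟨ρ, φ⟩ ⟨hρ, hφ⟩
    have hρ : 0 < ρ := hρ
    have hφ : φ ∈ Set.Ioo (-Real.pi) Real.pi := hφ
    have hsqrt : √((ρ * Real.cos φ) ^ 2 + (ρ * Real.sin φ) ^ 2) = ρ := by
      rw [show (ρ * Real.cos φ) ^ 2 + (ρ * Real.sin φ) ^ 2 =
        ρ ^ 2 * (Real.sin φ ^ 2 + Real.cos φ ^ 2) by ring, Real.sin_sq_add_cos_sq, mul_one,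
        Real.sqrt_sq hρ.le]
    have hdiv : ρ⁻¹ * (ρ * Real.cos φ) = Real.cos φ := by field_simp
    simp only [polarCoord_symm_apply, hG, hsqrt, hdiv, smul_eq_mul]
    by_cases hφ0 : 0 < φ
    · have hs : 0 < Real.sin φ := Real.sin_pos_of_pos_of_lt_pi hφ0 hφ.2
      rw [Set.indicator_of_mem (show ρ * Real.sin φ ∈ Set.Ioi (0 : ℝ) from mul_pos hρ hs),
        Set.indicator_of_mem (show φ ∈ Set.Ioo 0 Real.pi from ⟨hφ0, hφ.2⟩), Pi.one_apply, one_mul,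
        mul_pow, ENNReal.ofReal_mul (by positivity), pow_succ, ENNReal.ofReal_mul (by positivity)]
      ring
    · have hs : Real.sin φ ≤ 0 :=
        Real.sin_nonpos_of_nonpos_of_neg_pi_le (not_lt.mp hφ0) hφ.1.le
      rw [Set.indicator_of_notMem (s := Set.Ioi (0 : ℝ)), Set.indicator_of_notMem
        (s := Set.Ioo 0 Real.pi)]
      · simp
      · exact fun h => hφ0 h.1
      · exact fun h => absurd h (not_lt.mpr (mul_nonpos_of_nonneg_of_nonpos hρ.le hs))
  rw [h1, ← lintegral_comp_polarCoord_symm,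
    setLIntegral_congr_fun polarCoord.open_target.measurableSet h2, polarCoord_target,
    Measure.volume_eq_prod, ← Measure.prod_restrict,
    lintegral_prod_mul (f := fun ρ => ENNReal.ofReal (ρ ^ (k + 1)) * w ρ)
      (g := (Set.Ioo 0 Real.pi).indicator fun φ => T.indicator 1 (Real.cos φ) *
        ENNReal.ofReal (Real.sin φ ^ k)) (by fun_prop)
    (Measurable.aemeasurable (Measurable.indicator (by fun_prop) measurableSet_Ioo)),
    lintegral_indicator measurableSet_Ioo, Measure.restrict_restrict measurableSet_Ioo,
    Set.inter_eq_left.mpr (Set.Ioo_subset_Ioo_left (by linarith [Real.pi_pos])), cosineMass]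

/-- Under a rotation invariant density, the cosine of the angle to a fixed unit vector has the
density `sin φ ^ (m - 2)` in the angle, up to a constant. -/
theorem exists_lintegral_radial_cosine {m : ℕ} (hm : 2 ≤ m) {w : ℝ → ℝ≥0∞} (hw : Measurable w) :
    ∃ Z : ℝ≥0∞, ∀ u : EuclideanSpace ℝ (Fin m), ‖u‖ = 1 → ∀ T : Set ℝ, MeasurableSet T →
      ∫⁻ x : EuclideanSpace ℝ (Fin m), w ‖x‖ * T.indicator 1 (‖x‖⁻¹ * inner ℝ x u) =
        Z * cosineMass (m - 2) T := by
  obtain ⟨k, rfl⟩ : ∃ k, m = k + 1 + 1 := ⟨m - 2, by omega⟩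
  refine ⟨(volume : Measure (EuclideanSpace ℝ (Fin (k + 1)))).toSphere Set.univ *
    ∫⁻ ρ in Set.Ioi (0 : ℝ), ENNReal.ofReal (ρ ^ (k + 1)) * w ρ, fun u hu T hT => ?_⟩
  have hind : Measurable (T.indicator (1 : ℝ → ℝ≥0∞)) := measurable_one.indicator hT
  set e : EuclideanSpace ℝ (Fin (k + 1 + 1)) := EuclideanSpace.single 0 1 with he
  have hnorm : ‖u‖ = ‖e‖ := by rw [hu, he]; simp
  -- This reflection swaps u and e and preserves norm and volume, so Z does not depend on u.
  set R := (Submodule.span ℝ {u - e})ᗮ.reflection with hR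
  have hRu : R u = e := Submodule.reflection_sub hnorm
  have hRx : ∀ x, inner ℝ x u = (R x) 0 := by
    intro x
    rw [← R.inner_map_map, hRu, he, EuclideanSpace.inner_single_right]
    simp
  have h1 : ∫⁻ x : EuclideanSpace ℝ (Fin (k + 1 + 1)),
      w ‖x‖ * T.indicator 1 (‖x‖⁻¹ * inner ℝ x u) =
      ∫⁻ x : EuclideanSpace ℝ (Fin (k + 1 + 1)), w ‖x‖ * T.indicator 1 (‖x‖⁻¹ * x 0) := by
    conv_rhs => rw [← R.measurePreserving.lintegral_comp (by fun_prop)]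
    simp only [hRx, R.norm_map]
  have h2 := (measurePreserving_euclidean_cons (k + 1)).lintegral_comp
    (f := fun p : ℝ × EuclideanSpace ℝ (Fin (k + 1)) => w √(p.1 ^ 2 + ‖p.2‖ ^ 2) *
      T.indicator 1 ((√(p.1 ^ 2 + ‖p.2‖ ^ 2))⁻¹ * p.1)) (by fun_prop)
  simp only [← norm_euclidean_cons] at h2
  rw [h1, h2, Measure.volume_eq_prod, lintegral_prod _ (by fun_prop)]
  have h3 : ∀ h : ℝ, ∫⁻ y : EuclideanSpace ℝ (Fin (k + 1)), w √(h ^ 2 + ‖y‖ ^ 2) *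
      T.indicator 1 ((√(h ^ 2 + ‖y‖ ^ 2))⁻¹ * h) =
      (volume : Measure (EuclideanSpace ℝ (Fin (k + 1)))).toSphere Set.univ *
      ∫⁻ r in Set.Ioi (0 : ℝ), ENNReal.ofReal (r ^ k) *
      (w √(h ^ 2 + r ^ 2) * T.indicator 1 ((√(h ^ 2 + r ^ 2))⁻¹ * h)) := by
    intro h
    have := lintegral_fun_norm_addHaar (volume : Measure (EuclideanSpace ℝ (Fin (k + 1))))
      (f := fun r => w √(h ^ 2 + r ^ 2) * T.indicator 1 ((√(h ^ 2 + r ^ 2))⁻¹ * h)) (by fun_prop)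
    simpa using this
  simp only [h3]
  rw [lintegral_const_mul _ (Measurable.lintegral_prod_right (by fun_prop)), lintegral_halfPlane_polar k hw hT, mul_assoc]
  rfl

end Radial

/-! ### The cosine law and its consequences for both random models. -/

section AngularLaw

open scoped ENNReal

theorem setLIntegral_Icc_sin_pow (k : ℕ) {a b : ℝ} (ha : 0 ≤ a) (hab : a ≤ b)
    (hb : b ≤ Real.pi) :
    ∫⁻ φ in Set.Icc a b, ENNReal.ofReal (Real.sin φ ^ k) =
      ENNReal.ofReal (∫ φ in a..b, Real.sin φ ^ k) := by
  have hcont : Continuous fun φ : ℝ => Real.sin φ ^ k := by fun_prop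
  rw [intervalIntegral.integral_of_le hab, ← integral_Icc_eq_integral_Ioc,
    ofReal_integral_eq_lintegral_ofReal hcont.continuousOn.integrableOn_Icc]
  filter_upwards [ae_restrict_mem measurableSet_Icc] with φ hφ
  exact pow_nonneg (Real.sin_nonneg_of_nonneg_of_le_pi (ha.trans hφ.1) (hφ.2.trans hb)) k

theorem cosineMass_univ (k : ℕ) :
    cosineMass k Set.univ = ENNReal.ofReal (sinPowIntegral k Real.pi) := by
  rw [cosineMass, sinPowIntegral, ← setLIntegral_Icc_sin_pow k le_rfl Real.pi_pos.le le_rfl,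
    setLIntegral_congr Ioo_ae_eq_Icc]
  simp

theorem cosineMass_le_of_forall {j k : ℕ} (hjk : j ≤ k) {T : Set ℝ} {a b : ℝ} (ha : 0 ≤ a)
    (hab : a ≤ b) (hb : b ≤ Real.pi)
    (h : ∀ φ ∈ Set.Ioo 0 Real.pi, Real.cos φ ∈ T → φ ∈ Set.Icc a b) :
    cosineMass k T ≤ ENNReal.ofReal (∫ φ in a..b, Real.sin φ ^ j) := by
  rw [← setLIntegral_Icc_sin_pow j ha hab hb, cosineMass, ← lintegral_indicator measurableSet_Ioo,
    ← lintegral_indicator measurableSet_Icc]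
  refine lintegral_mono fun φ => ?_
  by_cases hφ : φ ∈ Set.Ioo 0 Real.pi
  · rw [Set.indicator_of_mem hφ]
    by_cases hT : Real.cos φ ∈ T
    · rw [Set.indicator_of_mem hT, Set.indicator_of_mem (h φ hφ hT), Pi.one_apply, one_mul]
      exact ENNReal.ofReal_le_ofReal (pow_le_pow_of_le_one
        (Real.sin_nonneg_of_nonneg_of_le_pi hφ.1.le hφ.2.le) (Real.sin_le_one φ) hjk)
    · rw [Set.indicator_of_notMem hT, zero_mul]; exact zero_le
  · rw [Set.indicator_of_notMem hφ]; exact zero_le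

theorem cosineMass_Iic_le (k : ℕ) (s : ℝ) :
    cosineMass k (Set.Iic s) ≤
      ENNReal.ofReal (sinPowIntegral k Real.pi - sinPowIntegral k (Real.arccos s)) := by
  have hcont : Continuous fun φ : ℝ => Real.sin φ ^ k := by fun_prop
  rw [sinPowIntegral, sinPowIntegral, intervalIntegral.integral_interval_sub_left
    (hcont.intervalIntegrable _ _) (hcont.intervalIntegrable _ _)]
  refine cosineMass_le_of_forall le_rfl (Real.arccos_nonneg s) (Real.arccos_le_pi s) le_rfl
    fun φ hφ hT => ⟨?_, hφ.2.le⟩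
  rw [← Real.arccos_cos hφ.1.le hφ.2.le]
  exact Real.antitone_arccos hT

/-- On [0, π], sin^k ≤ sin once k ≥ 1, and the integral of sin is explicit. With k = m - 2 this is
where m ≥ 3 is needed. -/
theorem cosineMass_Icc_le {k : ℕ} (hk : 1 ≤ k) {s : ℝ} (hs : 0 ≤ s) :
    cosineMass k (Set.Icc (-s) s) ≤ ENNReal.ofReal (2 * s) := by
  refine (cosineMass_le_of_forall hk (Real.arccos_nonneg s)
    (Real.antitone_arccos (neg_le_self hs)) (Real.arccos_le_pi (-s))
    fun φ hφ hT => ?_).trans (ENNReal.ofReal_le_ofReal ?_)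
  · rw [← Real.arccos_cos hφ.1.le hφ.2.le]
    exact ⟨Real.antitone_arccos hT.2, Real.antitone_arccos hT.1⟩
  · simp only [pow_one, integral_sin, Real.arccos_neg, Real.cos_pi_sub]
    have : Real.cos (Real.arccos s) ≤ s := by
      rcases le_total s 1 with h | h
      · rw [Real.cos_arccos (by linarith) h]
      · exact (Real.cos_le_one _).trans h
    linarith

theorem sinPowIntegral_pi_pos (k : ℕ) : 0 < sinPowIntegral k Real.pi := integral_sin_pow_pos k

theorem sinPowIntegral_mul_succ (k : ℕ) :
    sinPowIntegral k Real.pi * sinPowIntegral (k + 1) Real.pi = 2 * Real.pi / (k + 1) := by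
  induction k with
  | zero => simp [sinPowIntegral]; ring
  | succ k ih =>
    have h : sinPowIntegral (k + 1 + 1) Real.pi =
        (k + 1) / (k + 2) * sinPowIntegral k Real.pi := by
      have := integral_sin_pow (a := 0) (b := Real.pi) k
      simpa [sinPowIntegral] using this
    rw [h, mul_left_comm, mul_comm (sinPowIntegral (k + 1) _), ih]
    push_cast
    have : (k : ℝ) + 1 ≠ 0 := by positivity
    have : (k : ℝ) + 2 ≠ 0 := by positivity
    have : (k : ℝ) + 1 + 1 ≠ 0 := by positivity
    field_simp
    ring

/-- Since I_k decreases in k, I_k(π)² ≥ I_k(π) I_{k+1}(π) = 2π/(k+1) ≥ 4/(k+2). -/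
theorem two_le_sqrt_mul_sinPowIntegral (k : ℕ) :
    2 ≤ √(k + 2 : ℝ) * sinPowIntegral k Real.pi := by
  have h1 := sinPowIntegral_mul_succ k
  have h2 : sinPowIntegral (k + 1) Real.pi ≤ sinPowIntegral k Real.pi :=
    integral_sin_pow_succ_le k
  have hpos := sinPowIntegral_pi_pos k
  have h3 : 2 * Real.pi / (k + 1) ≤ sinPowIntegral k Real.pi ^ 2 := by
    rw [← h1, sq]; gcongr
  have h4 : 4 / (k + 2 : ℝ) ≤ 2 * Real.pi / (k + 1) := by
    rw [div_le_div_iff₀ (by positivity) (by positivity)]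
    have := Real.pi_gt_three
    have hk : (0 : ℝ) ≤ k := by positivity
    nlinarith
  refine le_of_sq_le_sq ?_ (by positivity)
  rw [mul_pow, Real.sq_sqrt (by positivity)]
  have : 4 / (k + 2 : ℝ) ≤ sinPowIntegral k Real.pi ^ 2 := h4.trans h3
  rw [div_le_iff₀ (by positivity)] at this
  linarith

/-- The cosine of the angle between a `ν`-random unit vector and any fixed direction is distributed
as for the uniform measure on the sphere. -/
def HasCosineLaw (m : ℕ) (ν : Measure (EuclideanSpace ℝ (Fin m))) : Prop :=
  ∀ u : EuclideanSpace ℝ (Fin m), ‖u‖ = 1 → ∀ T : Set ℝ, MeasurableSet T →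
    ν {a | inner ℝ a u ∈ T} = cosineMass (m - 2) T / cosineMass (m - 2) Set.univ

theorem HasCosineLaw.measure_inner_le {m : ℕ} {ν : Measure (EuclideanSpace ℝ (Fin m))}
    (h : HasCosineLaw m ν) {u : EuclideanSpace ℝ (Fin m)} (hu : ‖u‖ = 1) (s : ℝ) :
    ν {a | inner ℝ a u ≤ s} ≤ ENNReal.ofReal
      (1 - sinPowIntegral (m - 2) (Real.arccos s) / sinPowIntegral (m - 2) Real.pi) := by
  have hpos := sinPowIntegral_pi_pos (m - 2)
  refine (h u hu (Set.Iic s) measurableSet_Iic).trans_le ?_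
  rw [cosineMass_univ, one_sub_div hpos.ne', ENNReal.ofReal_div_of_pos hpos]
  gcongr
  exact cosineMass_Iic_le _ _

theorem HasCosineLaw.measure_abs_inner_le {m : ℕ} (hm : 3 ≤ m)
    {ν : Measure (EuclideanSpace ℝ (Fin m))} (h : HasCosineLaw m ν)
    {u : EuclideanSpace ℝ (Fin m)} (hu : ‖u‖ = 1) {s : ℝ} (hs : 0 ≤ s) :
    ν {a | |inner ℝ a u| ≤ s} ≤ ENNReal.ofReal (√m * s) := by
  have hpos := sinPowIntegral_pi_pos (m - 2)
  have hset : {a : EuclideanSpace ℝ (Fin m) | |inner ℝ a u| ≤ s} =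
      {a | inner ℝ a u ∈ Set.Icc (-s) s} := by
    ext a; simp [abs_le]
  rw [hset, h u hu _ measurableSet_Icc, cosineMass_univ]
  refine (ENNReal.div_le_div_right (cosineMass_Icc_le (by omega) hs) _).trans ?_
  rw [← ENNReal.ofReal_div_of_pos hpos]
  refine ENNReal.ofReal_le_ofReal ?_
  rw [div_le_iff₀ hpos]
  have := two_le_sqrt_mul_sinPowIntegral (m - 2)
  rw [show ((m - 2 : ℕ) : ℝ) + 2 = m by rw [Nat.cast_sub (by omega)]; push_cast; ring] at this
  nlinarith

/-- If a random vector has a rotation invariant density, then its direction has the cosine law. -/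
theorem hasCosineLaw_of_density {m : ℕ} (hm : 2 ≤ m) {w : ℝ → ℝ≥0∞} (hw : Measurable w)
    (ν : Measure (EuclideanSpace ℝ (Fin m))) [IsProbabilityMeasure ν]
    (c : ℝ≥0∞) (hν : ∀ u : EuclideanSpace ℝ (Fin m), ‖u‖ = 1 → ∀ T : Set ℝ, MeasurableSet T →
      ν {a | inner ℝ a u ∈ T} =
        c * ∫⁻ x : EuclideanSpace ℝ (Fin m), w ‖x‖ * T.indicator 1 (‖x‖⁻¹ * inner ℝ x u)) :
    HasCosineLaw m ν := by
  obtain ⟨Z, hZ⟩ := exists_lintegral_radial_cosine hm hw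
  intro u hu T hT
  have h1 := hν u hu Set.univ .univ
  rw [hZ u hu _ .univ, ← mul_assoc] at h1
  simp only [Set.mem_univ, Set.ofPred_true, measure_univ] at h1
  rw [hν u hu T hT, hZ u hu T hT, ← mul_assoc, ENNReal.eq_inv_of_mul_eq_one_left h1.symm,
    ENNReal.div_eq_inv_mul]

theorem isProbabilityMeasure_sphereUniform {m : ℕ} (hm : 0 < m) :
    IsProbabilityMeasure (sphereUniform m) := by
  have : Nontrivial (EuclideanSpace ℝ (Fin m)) :=
    Module.finrank_pos_iff (R := ℝ).mp (by simpa using hm)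
  refine ⟨?_⟩
  rw [sphereUniform, Measure.map_apply measurable_subtype_coe .univ, Set.preimage_univ,
    Measure.smul_apply, smul_eq_mul]
  refine ENNReal.inv_mul_cancel ?_ (measure_ne_top _ _)
  rw [Measure.measure_univ_ne_zero]
  exact Measure.toSphere_ne_zero _

/-- Surface measure is the dimension times the volume of the cone over a set in the unit ball, so
the indicator of r < 1 serves as radial density. The origin is the only possible discrepancy. -/
theorem hasCosineLaw_sphereUniform {m : ℕ} (hm : 2 ≤ m) : HasCosineLaw m (sphereUniform m) := by
  have : Nontrivial (EuclideanSpace ℝ (Fin m)) :=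
    Module.finrank_pos_iff.mp (by rw [finrank_euclideanSpace_fin]; omega)
  set σ := (volume : Measure (EuclideanSpace ℝ (Fin m))).toSphere with hσ
  have hprob := isProbabilityMeasure_sphereUniform (m := m) (by omega)
  refine hasCosineLaw_of_density hm (w := (Set.Iio (1 : ℝ)).indicator 1)
    (measurable_one.indicator measurableSet_Iio) _
    ((σ Set.univ)⁻¹ * Module.finrank ℝ (EuclideanSpace ℝ (Fin m))) fun u hu T hT => ?_
  have hSm : MeasurableSet {a : EuclideanSpace ℝ (Fin m) | inner ℝ a u ∈ T} :=
    (by fun_prop : Measurable fun a : EuclideanSpace ℝ (Fin m) => inner ℝ a u) hT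
  have hVm : MeasurableSet {x : EuclideanSpace ℝ (Fin m) | ‖x‖ < 1 ∧ ‖x‖⁻¹ * inner ℝ x u ∈ T} :=
    (measurableSet_lt measurable_norm measurable_const).inter
      ((by fun_prop : Measurable fun x : EuclideanSpace ℝ (Fin m) => ‖x‖⁻¹ * inner ℝ x u) hT)
  have hint : ∫⁻ x : EuclideanSpace ℝ (Fin m), (Set.Iio (1 : ℝ)).indicator 1 ‖x‖ *
      T.indicator 1 (‖x‖⁻¹ * inner ℝ x u) =
      volume {x : EuclideanSpace ℝ (Fin m) | ‖x‖ < 1 ∧ ‖x‖⁻¹ * inner ℝ x u ∈ T} := by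
    rw [← lintegral_indicator_one hVm]
    refine lintegral_congr fun x => ?_
    by_cases h1 : ‖x‖ < 1 <;> by_cases h2 : ‖x‖⁻¹ * inner ℝ x u ∈ T <;>
      simp [Set.indicator, h1, h2]
  rw [hint, sphereUniform, Measure.map_apply measurable_subtype_coe hSm, Measure.smul_apply,
    smul_eq_mul, Measure.toSphere_apply' _ (measurable_subtype_coe hSm), mul_assoc]
  congr 2
  refine (measure_congr (ae_eq_set.mpr ⟨?_, ?_⟩))
  · refine measure_mono_null (fun x hx => ?_) (measure_empty (μ := volume))
    obtain ⟨⟨r, hr, _, ⟨y, hy, rfl⟩, rfl⟩, hx⟩ := hx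
    have hy1 : ‖(y : EuclideanSpace ℝ (Fin m))‖ = 1 := by simp
    have hnorm : ‖r • (y : EuclideanSpace ℝ (Fin m))‖ = r := by
      rw [norm_smul, hy1, mul_one, Real.norm_of_nonneg hr.1.le]
    refine hx ⟨?_, ?_⟩
    · exact hnorm.trans_lt hr.2
    · change ‖r • (y : EuclideanSpace ℝ (Fin m))‖⁻¹ *
        inner ℝ (r • (y : EuclideanSpace ℝ (Fin m))) u ∈ T
      rw [hnorm, real_inner_smul_left, inv_mul_cancel_left₀ hr.1.ne']
      exact hy
  · refine measure_mono_null (fun x hx => ?_) (measure_singleton (0 : EuclideanSpace ℝ (Fin m)))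
    obtain ⟨⟨hx1, hxT⟩, hx⟩ := hx
    by_contra hx0
    have hx0 : x ≠ 0 := hx0
    refine hx ⟨‖x‖, ⟨norm_pos_iff.mpr hx0, hx1⟩, ‖x‖⁻¹ • x,
      ⟨⟨‖x‖⁻¹ • x, mem_sphere_zero_iff_norm.mpr (norm_smul_inv_norm hx0)⟩, ?_, rfl⟩, ?_⟩
    · change inner ℝ (‖x‖⁻¹ • x) u ∈ T
      rwa [real_inner_smul_left]
    · exact smul_inv_smul₀ (norm_ne_zero_iff.mpr hx0) x

theorem pi_gaussianReal_eq_withDensity (m : ℕ) :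
    Measure.pi (fun _ : Fin m => gaussianReal 0 1) =
      (volume : Measure (Fin m → ℝ)).withDensity fun x => ∏ i, gaussianPDF 0 1 (x i) := by
  refine (Measure.pi_eq fun s hs => ?_)
  have hnn : ∀ x : ℝ, 0 ≤ gaussianPDFReal 0 1 x := gaussianPDFReal_nonneg 0 1
  rw [withDensity_apply _ (.univ_pi hs), volume_pi, Measure.restrict_pi_pi]
  have h1 : ∀ x : Fin m → ℝ, ∏ i, gaussianPDF 0 1 (x i) =
      ENNReal.ofReal (∏ i, gaussianPDFReal 0 1 (x i)) := fun x => by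
    rw [ENNReal.ofReal_prod_of_nonneg fun i _ => hnn _]; rfl
  have h2 : ∀ i, Integrable (gaussianPDFReal 0 1) (volume.restrict (s i)) := fun i =>
    (integrable_gaussianPDFReal 0 1).restrict
  simp only [h1]
  rw [← ofReal_integral_eq_lintegral_ofReal
    (Integrable.fintype_prod (f := fun _ : Fin m => gaussianPDFReal 0 1) h2)
    (Filter.Eventually.of_forall fun x => Finset.prod_nonneg fun i _ => hnn _),
    integral_fintype_prod_eq_prod (fun (_ : Fin m) => gaussianPDFReal 0 1),
    ENNReal.ofReal_prod_of_nonneg fun i _ => integral_nonneg hnn]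
  refine Finset.prod_congr rfl fun i _ => ?_
  rw [gaussianReal_of_var_ne_zero 0 one_ne_zero, withDensity_apply _ (hs i),
    ofReal_integral_eq_lintegral_ofReal (h2 i) (Filter.Eventually.of_forall hnn)]
  rfl

theorem prod_gaussianPDF (m : ℕ) (x : EuclideanSpace ℝ (Fin m)) :
    ∏ i, gaussianPDF 0 1 (x i) =
      ENNReal.ofReal ((√(2 * Real.pi))⁻¹ ^ m * Real.exp (-‖x‖ ^ 2 / 2)) := by
  have h1 : ∀ i, gaussianPDF 0 1 (x i) =
      ENNReal.ofReal ((√(2 * Real.pi))⁻¹ * Real.exp (-(x i) ^ 2 / 2)) := fun i => by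
    simp [gaussianPDF, gaussianPDFReal]
  simp only [h1]
  rw [← ENNReal.ofReal_prod_of_nonneg fun i _ => by positivity, Finset.prod_mul_distrib,
    ← Real.exp_sum, EuclideanSpace.norm_sq_eq]
  simp [Finset.sum_div, neg_div]

/-- The law of the direction of a standard Gaussian vector. -/
noncomputable def gaussianDirection (m : ℕ) : Measure (EuclideanSpace ℝ (Fin m)) :=
  (Measure.pi fun _ : Fin m => gaussianReal 0 1).map
    fun y => ‖(WithLp.toLp 2 y : EuclideanSpace ℝ (Fin m))‖⁻¹ • WithLp.toLp 2 y

theorem isProbabilityMeasure_gaussianDirection (m : ℕ) :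
    IsProbabilityMeasure (gaussianDirection m) :=
  Measure.isProbabilityMeasure_map (by fun_prop)

theorem hasCosineLaw_gaussianDirection {m : ℕ} (hm : 2 ≤ m) :
    HasCosineLaw m (gaussianDirection m) := by
  have hmeas : Measurable fun y : Fin m → ℝ =>
      ‖(WithLp.toLp 2 y : EuclideanSpace ℝ (Fin m))‖⁻¹ •
        (WithLp.toLp 2 y : EuclideanSpace ℝ (Fin m)) := by fun_prop
  have hprob := isProbabilityMeasure_gaussianDirection m
  refine hasCosineLaw_of_density hm
    (w := fun r => ENNReal.ofReal ((√(2 * Real.pi))⁻¹ ^ m * Real.exp (-r ^ 2 / 2)))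
    (by fun_prop) _ 1 fun u hu T hT => ?_
  have hSm : MeasurableSet {a : EuclideanSpace ℝ (Fin m) | inner ℝ a u ∈ T} :=
    (by fun_prop : Measurable fun a : EuclideanSpace ℝ (Fin m) => inner ℝ a u) hT
  have hind : Measurable (T.indicator (1 : ℝ → ℝ≥0∞)) := measurable_one.indicator hT
  rw [gaussianDirection, Measure.map_apply hmeas hSm, pi_gaussianReal_eq_withDensity,
    withDensity_apply _ (hmeas hSm), ← lintegral_indicator (hmeas hSm), one_mul,
    ← (PiLp.volume_preserving_toLp (Fin m)).lintegral_comp (by fun_prop)]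
  refine lintegral_congr fun y => ?_
  rw [← prod_gaussianPDF, ← real_inner_smul_left]
  by_cases h : inner ℝ (‖(WithLp.toLp 2 y : EuclideanSpace ℝ (Fin m))‖⁻¹ •
      (WithLp.toLp 2 y : EuclideanSpace ℝ (Fin m))) u ∈ T
  · rw [Set.indicator_of_mem h, Set.indicator_of_mem (by exact h)]
    simp
  · rw [Set.indicator_of_notMem h, Set.indicator_of_notMem (by exact h), mul_zero]

end AngularLaw

/-! ### From the condition number to directions of rows. -/

section ConditionNumber

open scoped ENNReal

/-- The direction of a vector, which is `0` for the zero vector. -/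
noncomputable def direction {m : ℕ} (v : EuclideanSpace ℝ (Fin m)) : EuclideanSpace ℝ (Fin m) :=
  ‖v‖⁻¹ • v

theorem angle_eq_arccos_direction {m : ℕ} (v x : EuclideanSpace ℝ (Fin m)) :
    InnerProductGeometry.angle v x = Real.arccos (inner ℝ (direction v) (direction x)) := by
  rw [InnerProductGeometry.angle, direction, direction, real_inner_smul_left, inner_smul_right]
  congr 1
  rw [div_eq_inv_mul, mul_inv, mul_assoc]

theorem direction_of_norm_eq_one {m : ℕ} {x : EuclideanSpace ℝ (Fin m)} (hx : ‖x‖ = 1) :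
    direction x = x := by
  rw [direction, hx, inv_one, one_smul]

theorem abs_inner_direction_le {m : ℕ} (v x : EuclideanSpace ℝ (Fin m)) :
    |inner ℝ (direction v) (direction x)| ≤ 1 := by
  have h : ∀ v : EuclideanSpace ℝ (Fin m), ‖direction v‖ ≤ 1 := fun v => by
    rw [direction, norm_smul, norm_inv, norm_norm]
    exact inv_mul_le_one
  exact (abs_real_inner_le_norm _ _).trans (mul_le_one₀ (h v) (norm_nonneg _) (h x))

section MinAngle

variable {n m : ℕ} (A : Matrix (Fin n) (Fin m) ℝ)

theorem minAngle_le (x : EuclideanSpace ℝ (Fin m)) (i : Fin n) :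
    minAngle A x ≤ InnerProductGeometry.angle (matRow A i) x :=
  ciInf_le ⟨0, by rintro _ ⟨j, rfl⟩; exact InnerProductGeometry.angle_nonneg _ _⟩ i

theorem minAngle_nonneg (x : EuclideanSpace ℝ (Fin m)) : 0 ≤ minAngle A x :=
  Real.iInf_nonneg fun _ => InnerProductGeometry.angle_nonneg _ _

theorem minAngle_le_maxMinAngle (hn : 0 < n) {x : EuclideanSpace ℝ (Fin m)} (hx : x ≠ 0) :
    minAngle A x ≤ maxMinAngle A :=
  le_ciSup (f := fun x : {x : EuclideanSpace ℝ (Fin m) // x ≠ 0} => minAngle A x)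
    ⟨Real.pi, by
      rintro _ ⟨y, rfl⟩
      exact (minAngle_le A y ⟨0, hn⟩).trans (InnerProductGeometry.angle_le_pi _ _)⟩ ⟨x, hx⟩

theorem maxMinAngle_nonneg : 0 ≤ maxMinAngle A := Real.iSup_nonneg fun _ => minAngle_nonneg A _

theorem maxMinAngle_le_pi (hn : 0 < n) : maxMinAngle A ≤ Real.pi :=
  Real.iSup_le (fun y => (minAngle_le A y ⟨0, hn⟩).trans (InnerProductGeometry.angle_le_pi _ _))
    Real.pi_pos.le

theorem exists_cos_maxMinAngle_le (hn : 0 < n) {x : EuclideanSpace ℝ (Fin m)} (hx : ‖x‖ = 1) :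
    ∃ i, Real.cos (maxMinAngle A) ≤ inner ℝ (direction (matRow A i)) x := by
  have : Nonempty (Fin n) := ⟨⟨0, hn⟩⟩
  obtain ⟨i, hi⟩ := exists_eq_ciInf_of_finite
    (f := fun i : Fin n => InnerProductGeometry.angle (matRow A i) x)
  have hx0 : x ≠ 0 := by rintro rfl; simp at hx
  have hle : InnerProductGeometry.angle (matRow A i) x ≤ maxMinAngle A :=
    hi.trans_le (minAngle_le_maxMinAngle A hn hx0)
  refine ⟨i, ?_⟩
  have habs := abs_le.mp (abs_inner_direction_le (matRow A i) x)
  have := Real.cos_le_cos_of_nonneg_of_le_pi (InnerProductGeometry.angle_nonneg _ _)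
    (maxMinAngle_le_pi A hn) hle
  rwa [angle_eq_arccos_direction, Real.cos_arccos habs.1 habs.2,
    direction_of_norm_eq_one hx] at this

/-- Compactness supplies a minimiser of max_i ⟨direction of row i, x⟩. With
`exists_cos_maxMinAngle_le` this identifies cos θ(A) as the min-max value. -/
theorem exists_forall_inner_le_cos_maxMinAngle (hn : 0 < n) (hm : 0 < m) :
    ∃ x : EuclideanSpace ℝ (Fin m), ‖x‖ = 1 ∧
      ∀ i, inner ℝ (direction (matRow A i)) x ≤ Real.cos (maxMinAngle A) := by
  have : Nonempty (Fin n) := ⟨⟨0, hn⟩⟩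
  have : Nontrivial (EuclideanSpace ℝ (Fin m)) :=
    Module.finrank_pos_iff (R := ℝ).mp (by simpa using hm)
  set g : EuclideanSpace ℝ (Fin m) → ℝ := fun x =>
    Finset.univ.sup' Finset.univ_nonempty fun i => inner ℝ (direction (matRow A i)) x with hg
  have hgc : Continuous g := by
    apply Continuous.finset_sup'_apply
    intro i _
    fun_prop
  obtain ⟨x, hx, hmin⟩ := (isCompact_sphere (0 : EuclideanSpace ℝ (Fin m)) 1).exists_isMinOn
    (NormedSpace.sphere_nonempty.mpr zero_le_one) hgc.continuousOn
  have hx1 : ‖x‖ = 1 := by simpa using hx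
  have hattain : ∀ y, ∃ i, g y = inner ℝ (direction (matRow A i)) y := fun y => by
    obtain ⟨i, -, hi⟩ := Finset.exists_mem_eq_sup' Finset.univ_nonempty
      fun i => inner ℝ (direction (matRow A i)) y
    exact ⟨i, hi⟩
  have hle : maxMinAngle A ≤ Real.arccos (g x) := by
    refine Real.iSup_le (fun y => ?_) (Real.arccos_nonneg _)
    obtain ⟨i, hi⟩ := hattain (direction y)
    refine (minAngle_le A y i).trans ?_
    rw [angle_eq_arccos_direction, ← hi]
    exact Real.antitone_arccos (hmin (mem_sphere_zero_iff_norm.mpr (norm_smul_inv_norm y.2)))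
  refine ⟨x, hx1, fun i => ?_⟩
  obtain ⟨k, hk⟩ := hattain x
  have habs := abs_le.mp (abs_inner_direction_le (matRow A k) x)
  rw [direction_of_norm_eq_one hx1, ← hk] at habs
  calc inner ℝ (direction (matRow A i)) x ≤ g x :=
        Finset.le_sup' (fun i => inner ℝ (direction (matRow A i)) x) (Finset.mem_univ i)
    _ = Real.cos (Real.arccos (g x)) := (Real.cos_arccos habs.1 habs.2).symm
    _ ≤ Real.cos (maxMinAngle A) :=
        Real.cos_le_cos_of_nonneg_of_le_pi (maxMinAngle_nonneg A) (Real.arccos_le_pi _) hle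

theorem abs_cos_maxMinAngle_le {t : ℝ} (ht : 1 ≤ t) (h : ENNReal.ofReal t ≤ condNumber A) :
    |Real.cos (maxMinAngle A)| ≤ 1 / t := by
  have ht0 : 0 < t := by linarith
  rw [condNumber, ENNReal.le_inv_iff_le_inv, ← ENNReal.ofReal_inv_of_pos ht0,
    ENNReal.ofReal_le_ofReal_iff (by positivity)] at h
  rwa [one_div]

end MinAngle

theorem sinPowIntegral_arccos_le (k : ℕ) (s : ℝ) :
    sinPowIntegral k (Real.arccos s) ≤ sinPowIntegral k Real.pi := by
  have hcont : Continuous fun φ : ℝ => Real.sin φ ^ k := by fun_prop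
  rw [← sub_nonneg, sinPowIntegral, sinPowIntegral, intervalIntegral.integral_interval_sub_left
    (hcont.intervalIntegrable _ _) (hcont.intervalIntegrable _ _)]
  exact intervalIntegral.integral_nonneg (Real.arccos_le_pi s) fun φ hφ =>
    pow_nonneg (Real.sin_nonneg_of_nonneg_of_le_pi ((Real.arccos_nonneg s).trans hφ.1) hφ.2) k

theorem measureReal_condNumber_le {Ω : Type*} [MeasurableSpace Ω] (P : Measure Ω)
    {n m : ℕ} (hm : 3 ≤ m) (hnm : m ≤ n)
    (A : Ω → Matrix (Fin n) (Fin m) ℝ) {ν : Measure (EuclideanSpace ℝ (Fin m))}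
    [IsProbabilityMeasure ν] (hν : HasCosineLaw m ν)
    (hA : HasLaw (fun ω i => direction (matRow (A ω) i)) (Measure.pi fun _ : Fin n => ν) P)
    {t : ℝ} (ht : 1 ≤ t) :
    P.real {ω | ENNReal.ofReal t ≤ condNumber (A ω)} ≤
      (n.choose m : ℝ) * (2 * (m : ℝ) ^ ((5 : ℝ) / 2)) *
        (1 - sinPowIntegral (m - 2) (Real.arccos (1 / t)) / sinPowIntegral (m - 2) Real.pi)
          ^ (n - m) * (1 / t) := by
  have hs : 0 ≤ 1 / t := by positivity
  set s := 1 / t with hst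
  set q := 1 - sinPowIntegral (m - 2) (Real.arccos s) / sinPowIntegral (m - 2) Real.pi with hq
  have hq0 : 0 ≤ q := sub_nonneg.mpr
    (div_le_one_of_le₀ (sinPowIntegral_arccos_le _ s) (sinPowIntegral_pi_pos _).le)
  have hpi := measure_pi_le (E := EuclideanSpace ℝ (Fin m)) (m := m) (r := n - m) (n := n)
    finrank_euclideanSpace_fin (by omega) (by omega) ν hs
    (κ := ENNReal.ofReal (√m * (m * s))) (q := ENNReal.ofReal q)
    -- A slab of half-width 0 has measure at most √m · 0, so hyperplanes through the origin are
    -- null.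
    (fun u hu => by
      have := hν.measure_abs_inner_le hm hu le_rfl
      simpa using this)
    (fun u hu => hν.measure_abs_inner_le hm hu (by positivity))
    (fun u hu => hν.measure_inner_le hu s)
  have hle : P {ω | ENNReal.ofReal t ≤ condNumber (A ω)} ≤
      n.choose m * (m * ENNReal.ofReal (√m * (m * s)) * (2 * ENNReal.ofReal q ^ (n - m))) := by
    -- `Measure.le_map_apply` holds for arbitrary sets, so the event need not be shown measurable.
    refine le_trans (le_trans (measure_mono ?_) (Measure.le_map_apply hA.aemeasurable _))
      (hA.map_eq ▸ hpi)
    intro ω hω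
    have hcos := abs_le.mp (abs_cos_maxMinAngle_le (A ω) ht hω)
    constructor
    · obtain ⟨x, hx, h⟩ := exists_forall_inner_le_cos_maxMinAngle (A ω) (by omega) (by omega)
      exact ⟨x, hx, fun i => (h i).trans hcos.2⟩
    · intro x hx
      obtain ⟨i, hi⟩ := exists_cos_maxMinAngle_le (A ω) (by omega) hx
      exact ⟨i, hcos.1.trans hi⟩
  -- One m counts the choices of the row near a hyperplane, one comes from the half-width m·s, and
  -- √m from the cosine law.
  have hpow : (m : ℝ) ^ ((5 : ℝ) / 2) = m * (m * √m) := by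
    have hm0 : (0 : ℝ) < m := by positivity
    rw [show (5 : ℝ) / 2 = 1 + 1 + 1 / 2 by norm_num, Real.rpow_add hm0, Real.rpow_add hm0,
      Real.rpow_one, ← Real.sqrt_eq_rpow, mul_assoc]
  refine ENNReal.toReal_le_of_le_ofReal (by positivity) (hle.trans_eq ?_)
  rw [← ENNReal.ofReal_pow hq0, ← ENNReal.ofReal_natCast, ← ENNReal.ofReal_natCast m,
    ← ENNReal.ofReal_ofNat 2, ← ENNReal.ofReal_mul (by positivity),
    ← ENNReal.ofReal_mul (by positivity), ← ENNReal.ofReal_mul (by positivity),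
    ← ENNReal.ofReal_mul (by positivity), hpow]
  congr 1
  ring

/-! ### Joint law of the row directions in the two models. -/

theorem ae_norm_eq_one_sphereUniform (m : ℕ) : ∀ᵐ a ∂(sphereUniform m), ‖a‖ = 1 := by
  rw [sphereUniform, ae_map_iff measurable_subtype_coe.aemeasurable
    (measurableSet_eq_fun measurable_norm measurable_const)]
  exact Filter.Eventually.of_forall fun a => by simp

theorem IsUniformRandomMatrix.hasLaw_direction {Ω : Type*} [MeasurableSpace Ω] {P : Measure Ω}
    [IsProbabilityMeasure P] {n m : ℕ} {A : Ω → Matrix (Fin n) (Fin m) ℝ}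
    (hA : IsUniformRandomMatrix A P) :
    HasLaw (fun ω i => direction (matRow (A ω) i))
      (Measure.pi fun _ : Fin n => sphereUniform m) P := by
  have hrow : HasLaw (fun ω i => matRow (A ω) i) (Measure.pi fun _ : Fin n => sphereUniform m) P :=
    ⟨aemeasurable_pi_lambda _ fun i => (hA.2 i).aemeasurable, by
      rw [(iIndepFun_iff_map_fun_eq_pi_map fun i => (hA.2 i).aemeasurable).mp hA.1]
      congr 1
      ext1 i
      exact (hA.2 i).map_eq⟩
  refine hrow.congr ?_
  have h : ∀ i, ∀ᵐ ω ∂P, ‖matRow (A ω) i‖ = 1 := fun i =>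
    ae_of_ae_map (hA.2 i).aemeasurable ((hA.2 i).map_eq ▸ ae_norm_eq_one_sphereUniform m)
  filter_upwards [ae_all_iff.mpr h] with ω hω
  ext1 i
  exact direction_of_norm_eq_one (hω i)

theorem hasLaw_curry_gaussian (n m : ℕ) :
    HasLaw (MeasurableEquiv.curry (Fin n) (Fin m) ℝ)
      (Measure.pi fun _ : Fin n => Measure.pi fun _ : Fin m => gaussianReal 0 1)
      (Measure.pi fun _ : Fin n × Fin m => gaussianReal 0 1) := by
  refine ⟨(MeasurableEquiv.measurable _).aemeasurable, ?_⟩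
  have := Measure.infinitePi_map_curry (fun (_ : Fin n) (_ : Fin m) => gaussianReal 0 1)
  simpa only [Measure.infinitePi_eq_pi] using this

theorem hasLaw_direction_pi_gaussian (n m : ℕ) :
    HasLaw (fun (y : Fin n → Fin m → ℝ) i =>
        direction (WithLp.toLp 2 (y i) : EuclideanSpace ℝ (Fin m)))
      (Measure.pi fun _ : Fin n => gaussianDirection m)
      (Measure.pi fun _ : Fin n => Measure.pi fun _ : Fin m => gaussianReal 0 1) := by
  have hmeas : Measurable fun y : Fin m → ℝ =>
      direction (WithLp.toLp 2 y : EuclideanSpace ℝ (Fin m)) := by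
    unfold direction
    fun_prop
  have hprob : IsProbabilityMeasure ((Measure.pi fun _ : Fin m => gaussianReal 0 1).map
      fun y => direction (WithLp.toLp 2 y : EuclideanSpace ℝ (Fin m))) :=
    Measure.isProbabilityMeasure_map hmeas.aemeasurable
  exact ⟨(measurable_pi_lambda _ fun i => hmeas.comp (measurable_pi_apply i)).aemeasurable,
    Measure.pi_map_pi fun _ => hmeas.aemeasurable⟩

theorem IsGaussianRandomMatrix.hasLaw_direction {Ω : Type*} [MeasurableSpace Ω] {P : Measure Ω}
    [IsProbabilityMeasure P] {n m : ℕ} {A : Ω → Matrix (Fin n) (Fin m) ℝ}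
    (hA : IsGaussianRandomMatrix A P) :
    HasLaw (fun ω i => direction (matRow (A ω) i))
      (Measure.pi fun _ : Fin n => gaussianDirection m) P := by
  have hent : HasLaw (fun ω (p : Fin n × Fin m) => A ω p.1 p.2)
      (Measure.pi fun _ => gaussianReal 0 1) P :=
    ⟨aemeasurable_pi_lambda _ fun p => (hA.2 p.1 p.2).aemeasurable, by
      refine ((iIndepFun_iff_map_fun_eq_pi_map
        fun p : Fin n × Fin m => (hA.2 p.1 p.2).aemeasurable).mp hA.1).trans ?_
      congr 1
      ext1 p
      exact (hA.2 p.1 p.2).map_eq⟩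
  exact (hasLaw_direction_pi_gaussian n m).comp ((hasLaw_curry_gaussian n m).comp hent)

end ConditionNumber

theorem mainTheorem1 {Ω : Type*} [MeasurableSpace Ω] (P : Measure Ω) [IsProbabilityMeasure P]
    (n m : ℕ) (hm : 3 ≤ m) (hnm : m ≤ n)
    (A : Ω → Matrix (Fin n) (Fin m) ℝ)
    (hA : IsUniformRandomMatrix A P ∨ IsGaussianRandomMatrix A P)
    (t : ℝ) (ht : 1 ≤ t) :
    P.real {ω | ENNReal.ofReal t ≤ condNumber (A ω)} ≤
      (n.choose m : ℝ) * (2 * (m : ℝ) ^ ((5 : ℝ) / 2)) *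
        (1 - sinPowIntegral (m - 2) (Real.arccos (1 / t)) / sinPowIntegral (m - 2) Real.pi)
          ^ (n - m) * (1 / t) := by
  rcases hA with hA | hA
  · have := isProbabilityMeasure_sphereUniform (m := m) (by omega)
    exact measureReal_condNumber_le P hm hnm A (hasCosineLaw_sphereUniform (by omega))
      hA.hasLaw_direction ht
  · have := isProbabilityMeasure_gaussianDirection m
    exact measureReal_condNumber_le P hm hnm A (hasCosineLaw_gaussianDirection (by omega))
      hA.hasLaw_direction ht
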